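/- Let $m\ge 0$ and let $K$ be an abstract simplicial complex on $[m]=\{1,\dots,m\}$, that is, a family of subsets of $[m]$ closed under taking subsets, with $\emptyset\in K$. For a family of pairs of spaces $(\underline X,\underline A)=\{(X_i,A_i)\}_{i=1}^m$ and $\sigma\in K$ put $D(\sigma)=\prod_{i=1}^m Y_i$, where $Y_i=X_i$ if $i\in\sigma$ and $Y_i=A_i$ if $i\notin\sigma$, and let $$Z(K;(\underline X,\underline A))=\bigcup_{\sigma\in K}D(\sigma)=\operatorname{colim}_{\sigma\in K}D(\sigma)\subseteq X_1\times\cdots\times X_m$$ be the polyhedral product, with the colimit topology. For $1\le i\le m$ let $X_*(i)$ be a simplicial space and $A_*(i)\subseteq X_*(i)$ a simplicial subspace. The spaces $Z(K;(\underline X_n,\underline A_n))$, $n\ge 0$, with the face and degeneracy operators of $X_*(1)\times\cdots\times X_*(m)$, form a simplicial space $Z(K;(\underline X_*,\underline A_*))$, with a levelwise inclusion $i_*$ into $X_*(1)\times\cdots\times X_*(m)$. Let $|X_*|$ denote the geometric realization, the quotient of $\coprod_n \Delta[n]\times X_n$ by the relations $(u,d_jx)\sim(\partial_ju,x)$ and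 $(\sigma_jv,y)\sim(v,s_jy)$. Let $(\underline{|X_*|},\underline{|A_*|})=\{(|X_*(i)|,|A_*(i)|)\}_{i=1}^m$, where $|A_*(i)|$ has its own realization topology, and let $i\colon Z(K;(\underline{|X_*|},\underline{|A_*|}))\to|X_*(1)|\times\cdots\times|X_*(m)|$ be the inclusion. Products, subspaces and the resulting polyhedral products are formed, throughout, either in all topological spaces (convention (I)) or in compactly generated spaces (convention (II): every product and subspace topology is replaced by the associated compactly generated topology). In either convention the following holds. The maps $|A_*(i)|\to|X_*(i)|$ and $|i_*|\colon |Z(K;(\underline X_*,\underline A_*))|\to |X_*(1)\times\cdots\times X_*(m)|$ are injective. The map $\pi\colon |X_*(1)\times\cdots\times X_*(m)|\to|X_*(1)|\times\cdots\times|X_*(m)|$ induced by the projections is a bijection, and its inverse $\eta$ restricts to a map $h\colon Z(K;(\underline{|X_*|},\underline{|A_*|}))\to|Z(K;(\underline X_*,\underline A_*))|$, that is, there is a commutative square $$|i_*|\circ h=\eta\circ i .$$ Furthermore, $h$ is a homeomorphism (and so is $\eta$) if one of the following holds: 1. in convention (I), every $X_*(i)$ is a countable simplicial set (all spaces $X_n(i)$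 are discrete and countable); 2. in convention (I), every $X_*(i)$ is a simplicial set (all spaces $X_n(i)$ are discrete) and every $|X_*(i)|$ is a locally finite CW complex (each point has a neighbourhood that meets only finitely many cells); 3. in convention (II), all spaces $X_n(i)$ are compactly generated and weak Hausdorff. -/

import Mathlib

open CategoryTheory Opposite Topology

universe u

namespace PolyhedralProduct

/-! ### Point-set conventions -/

/-- The two settings in which products, subspaces and unions of spaces are formed:
all topological spaces with the usual product and subspace topologies, or compactly generated
spaces, where every such topology is replaced by the associated compactly generated one. -/
inductive Convention where
  | classical
  | compactlyGenerated

/-- The topology that a convention puts on a set carrying the topology `t`. -/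
@[reducible]
def Convention.refine (c : Convention) {α : Type u} (t : TopologicalSpace α) :
    TopologicalSpace α :=
  match c with
  | .classical => t
  | .compactlyGenerated => @TopologicalSpace.compactlyGenerated.{u} α t

theorem Convention.refine_le (c : Convention) {α : Type u} (t : TopologicalSpace α) :
    c.refine t ≤ t := by
  cases c with
  | classical => exact le_refl t
  | compactlyGenerated =>
    let _ := t
    have h : Continuous[TopologicalSpace.compactlyGenerated.{u} α, t] (id : α → α) :=
      continuous_from_compactlyGenerated _ fun _ g => g.continuous
    exact continuous_id_iff_le.1 h

theorem Convention.continuous_refine (c : Convention) {α β : Type u}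
    {t : TopologicalSpace α} {s : TopologicalSpace β} {f : α → β} (hf : Continuous[t, s] f) :
    Continuous[c.refine t, c.refine s] f := by
  cases c with
  | classical => exact hf
  | compactlyGenerated =>
    let _ := t
    let _ := s
    refine @continuous_from_compactlyGenerated α β t
      (TopologicalSpace.compactlyGenerated.{u} β) f fun S g => ?_
    let F : (Σ (i : (S : CompHaus.{u}) × C(S, β)), i.fst) → β := fun ⟨⟨_, i⟩, x⟩ => i x
    have h : Continuous[inferInstance, TopologicalSpace.compactlyGenerated.{u} β] F :=
      continuous_coinduced_rng
    exact @Continuous.comp _ _ _ _ _ (TopologicalSpace.compactlyGenerated.{u} β) _ F h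
      (continuous_sigmaMk (σ := fun i : (S : CompHaus.{u}) × C(S, β) => (i.fst : Type u))
      (i := ⟨S, (⟨f, hf⟩ : C(α, β)).comp g⟩))

/-- Weak Hausdorff spaces: continuous images of compact Hausdorff spaces are closed. -/
def IsWeakHausdorff (Y : Type u) [TopologicalSpace Y] : Prop :=
  ∀ (S : CompHaus.{u}) (f : C(S, Y)), IsClosed (Set.range f)

/-! ### Products and polyhedral products of spaces -/

/-- The product of finitely many spaces, in the convention `c`. -/
def prodSpace (c : Convention) {m : ℕ} (X : Fin m → TopCat.{u}) : TopCat.{u} :=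
  @TopCat.of (∀ i, X i) (c.refine Pi.topologicalSpace)

theorem continuous_prodFun {m : ℕ} {X X' : Fin m → TopCat.{u}} (f : ∀ i, X i ⟶ X' i) :
    Continuous fun (x : ∀ i, X i) i => f i (x i) :=
  continuous_pi fun i => (f i).hom.continuous.comp (continuous_apply i)

/-- The map of products given by maps of the factors. -/
def prodSpaceMap (c : Convention) {m : ℕ} {X X' : Fin m → TopCat.{u}} (f : ∀ i, X i ⟶ X' i) :
    prodSpace c X ⟶ prodSpace c X' :=
  TopCat.ofHom (X := prodSpace c X) (Y := prodSpace c X')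
    { toFun := fun x i => f i (x i)
      continuous_toFun := c.continuous_refine (continuous_prodFun f) }

/-- The projection onto a factor. -/
def prodSpaceProj (c : Convention) {m : ℕ} (X : Fin m → TopCat.{u}) (i : Fin m) :
    prodSpace c X ⟶ X i :=
  TopCat.ofHom (X := prodSpace c X) (Y := X i)
    { toFun := fun x => x i
      continuous_toFun := continuous_le_dom (c.refine_le _) (continuous_apply i) }

/-- A pair `(X, A)`: a space `A` with its own topology and its inclusion map into `X`. -/
structure SpacePair where
  total : TopCat.{u}
  sub : TopCat.{u}
  incl : sub ⟶ total

/-- Maps of pairs. -/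
structure SpacePair.Hom (P Q : SpacePair.{u}) where
  total : P.total ⟶ Q.total
  sub : P.sub ⟶ Q.sub
  comm : ∀ a : P.sub, total (P.incl a) = Q.incl (sub a)

/-- The points of `D(σ) = ∏ Y i`, where `Y i = X i` for `i ∈ σ` and `Y i = A i` for `i ∉ σ`. -/
abbrev Block {m : ℕ} (P : Fin m → SpacePair.{u}) (σ : Finset (Fin m)) : Type u :=
  (∀ i : {i // i ∈ σ}, (P i).total) × (∀ i : {i // i ∉ σ}, (P i).sub)

/-- The map `D(σ) → ∏ X i`. -/
def blockMap {m : ℕ} (P : Fin m → SpacePair.{u}) (σ : Finset (Fin m)) (y : Block P σ) :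
    ∀ i, (P i).total :=
  fun i => if h : i ∈ σ then y.1 ⟨i, h⟩ else (P i).incl (y.2 ⟨i, h⟩)

theorem continuous_blockMap {m : ℕ} (P : Fin m → SpacePair.{u}) (σ : Finset (Fin m)) :
    Continuous (blockMap P σ) := by
  refine continuous_pi fun i => ?_
  by_cases h : i ∈ σ
  · simp only [blockMap, h, dite_true]
    fun_prop
  · simp only [blockMap, h, dite_false]
    exact (P i).incl.hom.continuous.comp ((continuous_apply _).comp continuous_snd)

/-- The underlying set of the polyhedral product, as a subset of `∏ X i`: the union over the
simplices `σ` of `K` of the (images of the) products `D(σ)`. -/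
def carrier {m : ℕ} (K : LowerSet (Finset (Fin m))) (P : Fin m → SpacePair.{u}) :
    Set (∀ i, (P i).total) :=
  {x | ∃ σ ∈ K, ∀ i, i ∉ σ → x i ∈ Set.range (P i).incl}

/-- The map `D(σ) → Z(K; (X, A))`. -/
def blockIncl {m : ℕ} (K : LowerSet (Finset (Fin m))) (P : Fin m → SpacePair.{u})
    (σ : {σ // σ ∈ K}) (y : Block P σ.1) : carrier K P :=
  ⟨blockMap P σ.1 y, σ.1, σ.2, fun i hi => ⟨y.2 ⟨i, hi⟩, by simp [blockMap, hi]⟩⟩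

/-- The topology of `Z(K; (X, A)) = colim D(σ)`: the finest one for which all the maps
`D(σ) → Z(K; (X, A))` are continuous, where `D(σ)` is a product in the convention `c`. -/
@[reducible]
def polyTopology (c : Convention) {m : ℕ} (K : LowerSet (Finset (Fin m)))
    (P : Fin m → SpacePair.{u}) : TopologicalSpace (carrier K P) :=
  ⨆ σ : {σ // σ ∈ K}, TopologicalSpace.coinduced (blockIncl K P σ)
    (c.refine (inferInstance : TopologicalSpace (Block P σ.1)))

/-- The polyhedral product `Z(K; (X, A))`. -/
def polyProd (c : Convention) {m : ℕ} (K : LowerSet (Finset (Fin m)))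
    (P : Fin m → SpacePair.{u}) : TopCat.{u} :=
  @TopCat.of (carrier K P) (polyTopology c K P)

/-- The inclusion `Z(K; (X, A)) → ∏ X i`. -/
def polyProdIncl (c : Convention) {m : ℕ} (K : LowerSet (Finset (Fin m)))
    (P : Fin m → SpacePair.{u}) : polyProd c K P ⟶ prodSpace c fun i => (P i).total :=
  TopCat.ofHom (X := polyProd c K P) (Y := prodSpace c fun i => (P i).total)
    { toFun := fun x => x.1
      continuous_toFun := continuous_iSup_dom.2 fun σ => continuous_coinduced_dom.2
        (c.continuous_refine (continuous_blockMap P σ.1)) }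

/-- The map on points of `D(σ)` given by maps of pairs. -/
def blockFun {m : ℕ} {P Q : Fin m → SpacePair.{u}} (f : ∀ i, (P i).Hom (Q i))
    (σ : Finset (Fin m)) (y : Block P σ) : Block Q σ :=
  (fun i => (f i).total (y.1 i), fun i => (f i).sub (y.2 i))

theorem continuous_blockFun {m : ℕ} {P Q : Fin m → SpacePair.{u}} (f : ∀ i, (P i).Hom (Q i))
    (σ : Finset (Fin m)) : Continuous (blockFun f σ) :=
  Continuous.prodMk
    (continuous_pi fun i : {i // i ∈ σ} => (f i).total.hom.continuous.comp
      ((continuous_apply i).comp continuous_fst))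
    (continuous_pi fun i : {i // i ∉ σ} => (f i).sub.hom.continuous.comp
      ((continuous_apply i).comp continuous_snd))

/-- The map on points of polyhedral products given by maps of pairs. -/
def polyFun {m : ℕ} (K : LowerSet (Finset (Fin m))) {P Q : Fin m → SpacePair.{u}}
    (f : ∀ i, (P i).Hom (Q i)) (x : carrier K P) : carrier K Q :=
  ⟨fun i => (f i).total (x.1 i), by
    obtain ⟨x, σ, hσ, hx⟩ := x
    refine ⟨σ, hσ, fun i hi => ?_⟩
    obtain ⟨a, ha⟩ := hx i hi
    exact ⟨(f i).sub a, by rw [← (f i).comm, ha]⟩⟩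

theorem polyFun_comp_blockIncl {m : ℕ} (K : LowerSet (Finset (Fin m)))
    {P Q : Fin m → SpacePair.{u}} (f : ∀ i, (P i).Hom (Q i)) (σ : {σ // σ ∈ K}) :
    polyFun K f ∘ blockIncl K P σ = blockIncl K Q σ ∘ blockFun f σ.1 := by
  funext y
  refine Subtype.ext (funext fun i => ?_)
  by_cases hi : i ∈ σ.1
  · simp [polyFun, blockIncl, blockMap, blockFun, hi]
  · simp [polyFun, blockIncl, blockMap, blockFun, hi, (f i).comm]

theorem continuous_polyFun (c : Convention) {m : ℕ} (K : LowerSet (Finset (Fin m)))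
    {P Q : Fin m → SpacePair.{u}} (f : ∀ i, (P i).Hom (Q i)) :
    Continuous[polyTopology c K P, polyTopology c K Q] (polyFun K f) := by
  refine continuous_iSup_dom.2 fun σ => continuous_coinduced_dom.2 <|
    continuous_iSup_rng (i := σ) ?_
  rw [polyFun_comp_blockIncl]
  exact @Continuous.comp _ _ _ (c.refine inferInstance) (c.refine inferInstance)
    (TopologicalSpace.coinduced (blockIncl K Q σ) (c.refine inferInstance)) _
    (blockIncl K Q σ) continuous_coinduced_rng
    (c.continuous_refine (continuous_blockFun f σ.1))

/-- The polyhedral product is natural for maps of pairs. -/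
def polyProdMap (c : Convention) {m : ℕ} (K : LowerSet (Finset (Fin m)))
    {P Q : Fin m → SpacePair.{u}} (f : ∀ i, (P i).Hom (Q i)) :
    polyProd c K P ⟶ polyProd c K Q :=
  TopCat.ofHom (X := polyProd c K P) (Y := polyProd c K Q)
    { toFun := polyFun K f
      continuous_toFun := continuous_polyFun c K f }

/-! ### Simplicial spaces -/

/-- A simplicial subspace `A` of a simplicial space `X`: subsets of the spaces `X n` that are
preserved by all simplicial operators. -/
structure SimplicialSubspace (X : SimplicialObject TopCat.{u}) where
  carrier : ∀ n : SimplexCategoryᵒᵖ, Set (X.obj n)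
  map_mem : ∀ {n k : SimplexCategoryᵒᵖ} (θ : n ⟶ k) {x : X.obj n},
    x ∈ carrier n → X.map θ x ∈ carrier k

/-- A simplicial subspace as a simplicial space, with the subspace topologies of the
convention `c`. -/
def SimplicialSubspace.toSimplicial {X : SimplicialObject TopCat.{u}} (A : SimplicialSubspace X)
    (c : Convention) : SimplicialObject TopCat.{u} where
  obj n := @TopCat.of (A.carrier n) (c.refine instTopologicalSpaceSubtype)
  map {n k} θ := @TopCat.ofHom _ _ (c.refine instTopologicalSpaceSubtype)
    (c.refine instTopologicalSpaceSubtype)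
    (@ContinuousMap.mk _ _ (c.refine instTopologicalSpaceSubtype)
      (c.refine instTopologicalSpaceSubtype)
      (fun a => ⟨X.map θ a.1, A.map_mem θ a.2⟩)
      (c.continuous_refine <|
        ((X.map θ).hom.continuous.comp continuous_subtype_val).subtype_mk _))
  map_id n := by
    ext a; exact ConcreteCategory.congr_hom (X.map_id n) a.1
  map_comp f g := by
    ext a; exact ConcreteCategory.congr_hom (X.map_comp f g) a.1

/-- The inclusion of a simplicial subspace. -/
def SimplicialSubspace.ι {X : SimplicialObject TopCat.{u}} (A : SimplicialSubspace X)
    (c : Convention) : A.toSimplicial c ⟶ X where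
  app _ := @TopCat.ofHom _ _ (c.refine instTopologicalSpaceSubtype) _
    (@ContinuousMap.mk _ _ (c.refine instTopologicalSpaceSubtype) _ Subtype.val
      (continuous_le_dom (c.refine_le _) continuous_subtype_val))
  naturality _ _ _ := rfl

/-- The `n`-th pair `(X n, A n)` of a pair of simplicial spaces. -/
def levelPair {X : SimplicialObject TopCat.{u}} (A : SimplicialSubspace X) (c : Convention)
    (n : SimplexCategoryᵒᵖ) : SpacePair.{u} where
  total := X.obj n
  sub := (A.toSimplicial c).obj n
  incl := (A.ι c).app n

/-- Simplicial operators are maps of pairs. -/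
def levelPairMap {X : SimplicialObject TopCat.{u}} (A : SimplicialSubspace X) (c : Convention)
    {n k : SimplexCategoryᵒᵖ} (θ : n ⟶ k) : (levelPair A c n).Hom (levelPair A c k) where
  total := X.map θ
  sub := (A.toSimplicial c).map θ
  comm _ := rfl

/-- The levelwise product of simplicial spaces. -/
def prodSimplicial (c : Convention) {m : ℕ} (X : Fin m → SimplicialObject TopCat.{u}) :
    SimplicialObject TopCat.{u} where
  obj n := prodSpace c fun i => (X i).obj n
  map θ := prodSpaceMap c fun i => (X i).map θ
  map_id n := by
    ext x; funext i; exact ConcreteCategory.congr_hom ((X i).map_id n) (x i)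
  map_comp f g := by
    ext x; funext i; exact ConcreteCategory.congr_hom ((X i).map_comp f g) (x i)

/-- The projection of the levelwise product onto a factor. -/
def prodSimplicialProj (c : Convention) {m : ℕ} (X : Fin m → SimplicialObject TopCat.{u})
    (i : Fin m) : prodSimplicial c X ⟶ X i where
  app n := prodSpaceProj c (fun i => (X i).obj n) i
  naturality _ _ _ := rfl

/-- The simplicial space `Z(K; (X_*, A_*))`, with `n`-th space `Z(K; (X_n, A_n))`. -/
def polyProdSimplicial (c : Convention) {m : ℕ} (K : LowerSet (Finset (Fin m)))
    {X : Fin m → SimplicialObject TopCat.{u}} (A : ∀ i, SimplicialSubspace (X i)) :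
    SimplicialObject TopCat.{u} where
  obj n := polyProd c K fun i => levelPair (A i) c n
  map θ := polyProdMap c K fun i => levelPairMap (A i) c θ
  map_id n := by
    ext x
    exact Subtype.ext (funext fun i => ConcreteCategory.congr_hom ((X i).map_id n) (x.1 i))
  map_comp f g := by
    ext x
    exact Subtype.ext (funext fun i => ConcreteCategory.congr_hom ((X i).map_comp f g) (x.1 i))

/-- The inclusion `i_* : Z(K; (X_*, A_*)) → X_*(1) × ⋯ × X_*(m)` of simplicial spaces. -/
def polyProdSimplicialIncl (c : Convention) {m : ℕ} (K : LowerSet (Finset (Fin m)))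
    {X : Fin m → SimplicialObject TopCat.{u}} (A : ∀ i, SimplicialSubspace (X i)) :
    polyProdSimplicial c K A ⟶ prodSimplicial c X where
  app n := polyProdIncl c K fun i => levelPair (A i) c n
  naturality _ _ _ := rfl

/-! ### Geometric realization -/

/-- The `n`-th space of a simplicial space. -/
abbrev level (X : SimplicialObject TopCat.{u}) (n : ℕ) : TopCat.{u} :=
  X.obj (op (SimplexCategory.mk n))

/-- The component of a map of simplicial spaces in degree `n`. -/
abbrev levelMap {X Y : SimplicialObject TopCat.{u}} (f : X ⟶ Y) (n : ℕ) : level X n ⟶ level Y n :=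
  f.app (op (SimplexCategory.mk n))

/-- The points of the disjoint union of the spaces `Δ[n] × X n`. -/
abbrev PreRealization (X : SimplicialObject TopCat.{u}) : Type u :=
  Σ n : ℕ, stdSimplex ℝ (Fin (n + 1)) × level X n

/-- The relations `(u, d_i x) ∼ (∂_i u, x)` and `(σ_j v, y) ∼ (v, s_j y)`. -/
inductive RealizationRel (X : SimplicialObject TopCat.{u}) :
    PreRealization X → PreRealization X → Prop
  | face (n : ℕ) (i : Fin (n + 2)) (u : stdSimplex ℝ (Fin (n + 1))) (x : level X (n + 1)) :
      RealizationRel X ⟨n, u, X.δ i x⟩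
        ⟨n + 1, stdSimplex.map (SimplexCategory.δ i) u, x⟩
  | degeneracy (n : ℕ) (j : Fin (n + 1)) (v : stdSimplex ℝ (Fin (n + 2))) (y : level X n) :
      RealizationRel X ⟨n, stdSimplex.map (SimplexCategory.σ j) v, y⟩
        ⟨n + 1, v, X.σ j y⟩

/-- The geometric realization `|X|`, with the quotient topology. (If all `X n` are compactly
generated, then so are all `Δ[n] × X n`, and hence `|X|`; so the same definition serves both
conventions.) -/
def realization (X : SimplicialObject TopCat.{u}) : TopCat.{u} :=
  TopCat.of (Quot (RealizationRel X))

/-- The point `[u, x]` of `|X|`. -/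
def realizationMk (X : SimplicialObject TopCat.{u}) (n : ℕ) (u : stdSimplex ℝ (Fin (n + 1)))
    (x : level X n) : realization X :=
  Quot.mk (RealizationRel X) ⟨n, u, x⟩

/-- The map on points of the disjoint unions given by a map of simplicial spaces. -/
def preRealizationMap {X Y : SimplicialObject TopCat.{u}} (f : X ⟶ Y) (p : PreRealization X) :
    PreRealization Y :=
  ⟨p.1, p.2.1, levelMap f p.1 p.2.2⟩

theorem preRealizationMap_rel {X Y : SimplicialObject TopCat.{u}} (f : X ⟶ Y)
    (p q : PreRealization X) (h : RealizationRel X p q) :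
    RealizationRel Y (preRealizationMap f p) (preRealizationMap f q) := by
  cases h with
  | face n i u x =>
    have e : levelMap f n (X.δ i x) = Y.δ i (levelMap f (n + 1) x) :=
      ConcreteCategory.congr_hom (f.naturality (SimplexCategory.δ i).op) x
    simp only [preRealizationMap, e]
    exact .face n i u _
  | degeneracy n j v y =>
    have e : levelMap f (n + 1) (X.σ j y) = Y.σ j (levelMap f n y) :=
      ConcreteCategory.congr_hom (f.naturality (SimplexCategory.σ j).op) y
    simp only [preRealizationMap, e]
    exact .degeneracy n j v _

theorem continuous_preRealizationMap {X Y : SimplicialObject TopCat.{u}} (f : X ⟶ Y) :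
    Continuous (preRealizationMap f) :=
  continuous_sigma fun n => continuous_sigmaMk.comp <|
    continuous_fst.prodMk ((levelMap f n).hom.continuous.comp continuous_snd)

/-- The map `|f| : |X| → |Y|`, `[u, x] ↦ [u, f x]`. -/
def realizationMap {X Y : SimplicialObject TopCat.{u}} (f : X ⟶ Y) :
    realization X ⟶ realization Y :=
  TopCat.ofHom (X := Quot (RealizationRel X)) (Y := Quot (RealizationRel Y))
    { toFun := Quot.map (preRealizationMap f) (preRealizationMap_rel f)
      continuous_toFun := continuous_quot_lift _
        (continuous_quot_mk.comp (continuous_preRealizationMap f)) }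

/-- The pair `(|X|, |A|)`. -/
def realizationPair {X : SimplicialObject TopCat.{u}} (A : SimplicialSubspace X)
    (c : Convention) : SpacePair.{u} where
  total := realization X
  sub := realization (A.toSimplicial c)
  incl := realizationMap (A.ι c)

/-- The canonical map `π = |π_1| × ⋯ × |π_m|` from `|X_*(1) × ⋯ × X_*(m)|` to
`|X_*(1)| × ⋯ × |X_*(m)|`. -/
def realizationProdProj (c : Convention) {m : ℕ} (X : Fin m → SimplicialObject TopCat.{u})
    (p : realization (prodSimplicial c X)) : prodSpace c fun i => realization (X i) :=
  fun i => realizationMap (prodSimplicialProj c X i) p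

/-! ### Finiteness conditions -/

/-- All the spaces `X n` are discrete, that is, `X` is a simplicial set. -/
def IsDiscrete (X : SimplicialObject TopCat.{u}) : Prop :=
  ∀ n : ℕ, DiscreteTopology (level X n)

/-- `X` is a simplicial set with countably many simplices. -/
def IsCountable (X : SimplicialObject TopCat.{u}) : Prop :=
  IsDiscrete X ∧ ∀ n : ℕ, Countable (level X n)

/-- The nondegenerate simplices of `X`. -/
abbrev NondegenerateSimplex (X : SimplicialObject TopCat.{u}) : Type u :=
  Σ n : ℕ, {x : level X n // x ∈ SSet.nonDegenerate (X ⋙ forget TopCat.{u}) n}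

/-- The closed cell of `|X|` that belongs to a simplex. -/
def closedCell (X : SimplicialObject TopCat.{u}) (s : NondegenerateSimplex X) :
    Set (realization X) :=
  Set.range fun v => realizationMk X s.1 v s.2.1

/-- `X` is a simplicial set and `|X|` is a locally finite CW complex: every point of `|X|` has
a neighbourhood that meets only finitely many cells. -/
def IsLocallyFinite (X : SimplicialObject TopCat.{u}) : Prop :=
  IsDiscrete X ∧ LocallyFinite (closedCell X)

/-- All the spaces `X n` are compactly generated and weak Hausdorff. -/
def IsCGWH (X : SimplicialObject TopCat.{u}) : Prop :=
  ∀ n : ℕ, CompactlyGeneratedSpace (level X n) ∧ IsWeakHausdorff (level X n)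

/-- The hypotheses under which products and realizations are compatible: for the usual product
topologies, all factors countable or all factors locally finite; for compactly generated
products, all factors compactly generated weak Hausdorff. -/
def Admissible : Convention → {m : ℕ} → (Fin m → SimplicialObject TopCat.{u}) → Prop
  | .classical, _, X => (∀ i, IsCountable (X i)) ∨ (∀ i, IsLocallyFinite (X i))
  | .compactlyGenerated, _, X => ∀ i, IsCGWH (X i)

end PolyhedralProduct

/-!
# Realization commutes with polyhedral products

A point `u` of `Δ[n]` is a step function from `[0, 1)` to `{0, …, n}` (`stepFun`), so a point
`[u, x]` of `|X|` assigns to each chain `τ` of `M + 1` points in `[0, 1)` an `M`-simplex of `X`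
(`evalAt`); this is independent of the representative because step functions are natural for pushforward
(`stepFun_map`). Conversely, a point is recovered from its values on any subdivision of `[0, 1)`
that is fine enough, and finitely many points, even of different realizations, have a common such
subdivision (`exists_adaptedPt`). All statements about underlying sets follow: realization
preserves levelwise injections, the projection `|∏ X i| → ∏ |X i|` is bijective, and its inverse
maps the polyhedral product of the realizations into the realization of the polyhedral products.

The projection and its restriction are continuous by the universal properties of the topologies; the
locally compact factors `Δ[n]` keep the quotient maps that define polyhedral products quotient maps
(`continuous_prod_polyProd`). For the inverse maps, the key is `continuous_of_levelwise`: a map on a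
finite product of realizations that is given levelwise is continuous on compact Hausdorff spaces
mapping to the product. To see this, lift the coordinates one at a time to the disjoint unions of
the spaces `Δ[n] × X n`, using that the product of a quotient map with a compact Hausdorff
space is a quotient map; once all coordinates are lifted, the product of simplices is covered by
the finitely many chambers of its subdivision, and on each chamber the map is visibly continuous.
It applies to `η` and, on each `D(σ)`, which is again a product of realizations, to `h`.

In the compactly generated convention, continuity on compact Hausdorff spaces is all that is
needed. In the classical convention it remains to see that a finite product of the realizations is
compactly generated. Realizations of simplicial sets are Hausdorff (`t2Space_realization`), as two
different step functions take different values at random chains in a common subdivision, and the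
probability of a value depends continuously on the point. A locally finite realization
is moreover locally compact, which settles that case; a countable realization has the
weak topology of an increasing sequence of compact sets, and finite products of such spaces are
compactly generated (`compactlyGeneratedSpace_pi`).
-/

namespace PolyhedralProduct

/-! ### The defining relations for arbitrary simplicial operators -/

theorem stdSimplex_map_map {a b c : SimplexCategory} (f : a ⟶ b) (g : b ⟶ c)
    (v : stdSimplex ℝ (Fin (a.len + 1))) :
    stdSimplex.map g (stdSimplex.map f v) = stdSimplex.map (f ≫ g) v := by
  rw [stdSimplex.map_comp_apply]
  rfl

/-- Every operator of the simplex category is a composite of faces and degeneracies, so the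
relations of the realization hold for all of them. -/
theorem realizationMk_map (X : SimplicialObject TopCat.{u}) {n k : ℕ}
    (φ : SimplexCategory.mk n ⟶ SimplexCategory.mk k)
    (v : stdSimplex ℝ (Fin (n + 1))) (x : level X k) :
    realizationMk X n v (X.map φ.op x) = realizationMk X k (stdSimplex.map φ v) x := by
  let W : MorphismProperty SimplexCategory := fun a b f =>
    ∀ (v : stdSimplex ℝ (Fin (a.len + 1))) (x : X.obj (op b)),
      realizationMk X a.len v (X.map f.op x) = realizationMk X b.len (stdSimplex.map f v) x
  have : W.IsMultiplicative :=
    { id_mem := fun a v x => by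
        have h1 : X.map (𝟙 a : a ⟶ a).op x = x := by
          rw [op_id]; exact ConcreteCategory.congr_hom (X.map_id (op a)) x
        have h2 : stdSimplex.map (𝟙 a : a ⟶ a) v = v := stdSimplex.map_id_apply v
        rw [h1, h2]
      comp_mem := fun {a b c} f g hf hg v x => by
        have h1 : X.map (f ≫ g).op x = X.map f.op (X.map g.op x) := by
          rw [op_comp]; exact ConcreteCategory.congr_hom (X.map_comp g.op f.op) x
        rw [h1, ← stdSimplex_map_map]
        exact (hf v _).trans (hg _ x) }
  have hW : W = ⊤ := SimplexCategory.morphismProperty_eq_top W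
    (fun i v x => Quot.sound (.face _ i v x)) (fun i v x => (Quot.sound (.degeneracy _ i v x)).symm)
  have hφ : W φ := by rw [hW]; trivial
  exact hφ v x

/-! ### Points of a simplex as step functions -/

/-- The partial sum `u 0 + ⋯ + u j`. -/
def partialSum {n : ℕ} (u : stdSimplex ℝ (Fin (n + 1))) (j : Fin (n + 1)) : ℝ :=
  ∑ l ∈ Finset.Iic j, u l

theorem partialSum_last {n : ℕ} (u : stdSimplex ℝ (Fin (n + 1))) :
    partialSum u (Fin.last n) = 1 := by
  have : Finset.Iic (Fin.last n) = Finset.univ := by ext; simp [Fin.le_last]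
  rw [partialSum, this, stdSimplex.sum_eq_one]

theorem partialSum_nonneg {n : ℕ} (u : stdSimplex ℝ (Fin (n + 1))) (j : Fin (n + 1)) :
    0 ≤ partialSum u j := Finset.sum_nonneg fun _ _ => stdSimplex.zero_le u _

theorem partialSum_mono {n : ℕ} (u : stdSimplex ℝ (Fin (n + 1))) : Monotone (partialSum u) :=
  fun _ _ h => Finset.sum_le_sum_of_subset_of_nonneg (Finset.Iic_subset_Iic.2 h)
    fun _ _ _ => stdSimplex.zero_le u _

theorem partialSum_le_one {n : ℕ} (u : stdSimplex ℝ (Fin (n + 1))) (j : Fin (n + 1)) :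
    partialSum u j ≤ 1 := partialSum_last u ▸ partialSum_mono u (Fin.le_last j)

theorem continuous_partialSum {n : ℕ} (j : Fin (n + 1)) :
    Continuous fun u : stdSimplex ℝ (Fin (n + 1)) => partialSum u j :=
  continuous_finsetSum _ fun l _ => (continuous_apply l).comp continuous_subtype_val

theorem eq_of_partialSum_eq {n : ℕ} {u w : stdSimplex ℝ (Fin (n + 1))}
    (h : ∀ j, partialSum u j = partialSum w j) : u = w := by
  ext j
  induction j using WellFoundedLT.induction with
  | ind j ih =>
    have hj := h j
    have e : Finset.Iic j = insert j (Finset.Iio j) := by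
      ext i; simp [le_iff_eq_or_lt]
    rw [partialSum, partialSum, e, Finset.sum_insert (by simp), Finset.sum_insert (by simp),
      Finset.sum_congr rfl fun l hl => ih l (Finset.mem_Iio.1 hl)] at hj
    linarith

theorem map_apply_eq_sum {n k : ℕ} (ψ : Fin (n + 1) → Fin (k + 1))
    (u : stdSimplex ℝ (Fin (n + 1))) (j : Fin (k + 1)) :
    stdSimplex.map ψ u j = ∑ l with ψ l = j, u l := by
  rw [stdSimplex.map_coe, FunOnFinite.linearMap_apply_apply]

theorem partialSum_map {n k : ℕ} (ψ : Fin (n + 1) → Fin (k + 1))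
    (u : stdSimplex ℝ (Fin (n + 1))) (j : Fin (k + 1)) :
    partialSum (stdSimplex.map ψ u) j = ∑ l with ψ l ≤ j, u l := by
  simp_rw [partialSum, map_apply_eq_sum]
  rw [← Finset.sum_fiberwise_of_maps_to (s := Finset.univ.filter fun l => ψ l ≤ j)
    (t := Finset.Iic j) (g := ψ) (by simp)]
  refine Finset.sum_congr rfl fun i hi => Finset.sum_congr ?_ fun _ _ => rfl
  ext l
  simp only [Finset.mem_filter, Finset.mem_univ, true_and, iff_and_self]
  rintro rfl
  exact Finset.mem_Iic.1 hi

/-- The half-open unit interval `[0, 1)`, the domain of step functions. -/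
abbrev HalfOpenUnit : Type := Set.Ico (0 : ℝ) 1

theorem exists_lt_partialSum {n : ℕ} (u : stdSimplex ℝ (Fin (n + 1))) (t : HalfOpenUnit) :
    (Finset.univ.filter fun j => t.1 < partialSum u j).Nonempty :=
  ⟨Fin.last n, by simp [partialSum_last, t.2.2]⟩

/-- The step function `[0, 1) → {0, …, n}` of a point `u` of `Δ[n]`: it takes the value `j` on a
half-open interval of length `u j`, and these intervals follow each other in order. -/
noncomputable def stepFun {n : ℕ} (u : stdSimplex ℝ (Fin (n + 1))) (t : HalfOpenUnit) :
    Fin (n + 1) :=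
  (Finset.univ.filter fun j => t.1 < partialSum u j).min' (exists_lt_partialSum u t)

theorem stepFun_le_iff {n : ℕ} (u : stdSimplex ℝ (Fin (n + 1))) (t : HalfOpenUnit)
    (j : Fin (n + 1)) : stepFun u t ≤ j ↔ t.1 < partialSum u j := by
  constructor
  · intro h
    have := Finset.min'_mem _ (exists_lt_partialSum u t)
    simp only [Finset.mem_filter, Finset.mem_univ, true_and] at this
    exact this.trans_le (partialSum_mono u h)
  · intro h
    exact Finset.min'_le _ _ (by simpa using h)

theorem stepFun_mono {n : ℕ} (u : stdSimplex ℝ (Fin (n + 1))) : Monotone (stepFun u) :=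
  fun s t h => (stepFun_le_iff u s _).2 <|
    lt_of_le_of_lt (show s.1 ≤ t.1 from h) ((stepFun_le_iff u t _).1 le_rfl)

/-- The step function of a pushforward is the composite step function. -/
theorem stepFun_map {n k : ℕ} (ψ : Fin (n + 1) →o Fin (k + 1))
    (u : stdSimplex ℝ (Fin (n + 1))) (t : HalfOpenUnit) :
    stepFun (stdSimplex.map ψ u) t = ψ (stepFun u t) := by
  refine eq_of_forall_ge_iff fun j => ?_
  rw [stepFun_le_iff, partialSum_map]
  constructor
  · intro h
    have hne : (Finset.univ.filter fun l => ψ l ≤ j).Nonempty := by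
      by_contra hne
      rw [Finset.not_nonempty_iff_eq_empty] at hne
      rw [hne, Finset.sum_empty] at h
      exact absurd t.2.1 (not_le.2 h)
    have hmax := Finset.max'_mem _ hne
    simp only [Finset.mem_filter, Finset.mem_univ, true_and] at hmax
    refine le_trans (ψ.monotone ?_) hmax
    rw [stepFun_le_iff]
    exact h.trans_le (Finset.sum_le_sum_of_subset_of_nonneg
      (fun l hl => Finset.mem_Iic.2 (Finset.le_max' _ l hl)) fun _ _ _ => stdSimplex.zero_le u _)
  · intro h
    refine ((stepFun_le_iff u t _).1 le_rfl).trans_le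
      (Finset.sum_le_sum_of_subset_of_nonneg (fun l hl => ?_) fun _ _ _ => stdSimplex.zero_le u _)
    simp only [Finset.mem_filter, Finset.mem_univ, true_and]
    exact (ψ.monotone (Finset.mem_Iic.1 hl)).trans h

/-- The operator `[M] → [n]` got by sampling a step function at the points of a chain in
`[0, 1)`. -/
noncomputable def sample {n M : ℕ} (u : stdSimplex ℝ (Fin (n + 1)))
    (τ : Fin (M + 1) →o HalfOpenUnit) :
    SimplexCategory.mk M ⟶ SimplexCategory.mk n :=
  SimplexCategory.mkHom ⟨fun k => stepFun u (τ k), (stepFun_mono u).comp τ.monotone⟩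

theorem sample_apply {n M : ℕ} (u : stdSimplex ℝ (Fin (n + 1)))
    (τ : Fin (M + 1) →o HalfOpenUnit) (k : Fin (M + 1)) : sample u τ k = stepFun u (τ k) := rfl

theorem sample_map {n k M : ℕ} (ψ : SimplexCategory.mk n ⟶ SimplexCategory.mk k)
    (u : stdSimplex ℝ (Fin (n + 1))) (τ : Fin (M + 1) →o HalfOpenUnit) :
    sample (stdSimplex.map ψ u) τ = sample u τ ≫ ψ := by
  ext i
  exact congrArg Fin.val (stepFun_map ψ.toOrderHom u (τ i))

/-- Evaluation of a point of `|X|` at a chain `τ` in `[0, 1)`: viewing `[u, x]` as a step function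
with values in `X`, this is the simplex that it assigns to `τ`. -/
noncomputable def evalAt (X : SimplicialObject TopCat.{u}) {M : ℕ}
    (τ : Fin (M + 1) →o HalfOpenUnit) :
    realization X → level X M :=
  Quot.lift (fun p => X.map (sample p.2.1 τ).op p.2.2) <| by
    rintro _ _ (⟨n, i, u, x⟩ | ⟨n, j, v, y⟩)
    · simp only [sample_map, op_comp]
      exact (ConcreteCategory.congr_hom (X.map_comp (SimplexCategory.δ i).op _) x).symm
    · simp only [sample_map, op_comp]
      exact ConcreteCategory.congr_hom (X.map_comp (SimplexCategory.σ j).op _) y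

theorem evalAt_mk (X : SimplicialObject TopCat.{u}) {M n : ℕ} (τ : Fin (M + 1) →o HalfOpenUnit)
    (u : stdSimplex ℝ (Fin (n + 1))) (x : level X n) :
    evalAt X τ (realizationMk X n u x) = X.map (sample u τ).op x := rfl

theorem exists_realizationMk (X : SimplicialObject TopCat.{u}) (p : realization X) :
    ∃ n u x, realizationMk X n u x = p := by
  obtain ⟨⟨n, u, x⟩, rfl⟩ := Quot.exists_rep p
  exact ⟨n, u, x, rfl⟩

theorem realizationMap_mk {X Y : SimplicialObject TopCat.{u}} (f : X ⟶ Y) (n : ℕ)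
    (u : stdSimplex ℝ (Fin (n + 1))) (x : level X n) :
    realizationMap f (realizationMk X n u x) = realizationMk Y n u (levelMap f n x) := rfl

theorem evalAt_realizationMap {X Y : SimplicialObject TopCat.{u}} (f : X ⟶ Y) {M : ℕ}
    (τ : Fin (M + 1) →o HalfOpenUnit) (p : realization X) :
    evalAt Y τ (realizationMap f p) = levelMap f M (evalAt X τ p) := by
  obtain ⟨n, u, x, rfl⟩ := exists_realizationMk X p
  rw [realizationMap_mk, evalAt_mk, evalAt_mk]
  exact (ConcreteCategory.congr_hom (f.naturality (sample u τ).op) x).symm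

/-! ### Common subdivisions -/

/-- A subdivision of `[0, 1)` into finitely many consecutive half-open intervals of positive
lengths, the coordinates of a point of a simplex. -/
structure Subdivision (M : ℕ) where
  /-- The lengths of the intervals. -/
  len : stdSimplex ℝ (Fin (M + 1))
  /-- The left end points of the intervals. -/
  left : Fin (M + 1) →o HalfOpenUnit
  len_pos : ∀ k, 0 < len k
  right_le_one : ∀ k, (left k).1 + len k ≤ 1
  right_le : ∀ k l, k < l → (left k).1 + len k ≤ (left l).1

/-- A subdivision is adapted to a point `u` of a simplex if the step function of `u` is constant
on each of its intervals, with sum of lengths `u j` over the intervals with value `j`. -/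
structure Subdivision.Adapted {M n : ℕ} (S : Subdivision M) (u : stdSimplex ℝ (Fin (n + 1))) :
    Prop where
  map_sample : stdSimplex.map (sample u S.left) S.len = u
  const : ∀ k (t : HalfOpenUnit), S.left k ≤ t → t.1 < (S.left k).1 + S.len k →
    stepFun u t = stepFun u (S.left k)

theorem sum_gaps {M : ℕ} (g : Fin (M + 2) → ℝ) (r : Fin (M + 2)) :
    ∑ k : Fin (M + 1) with k.castSucc < r, (g k.succ - g k.castSucc) = g r - g 0 := by
  induction r using Fin.induction with
  | zero => simp
  | succ i ih =>
    have e : (Finset.univ.filter fun k : Fin (M + 1) => k.castSucc < i.succ) =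
        insert i (Finset.univ.filter fun k : Fin (M + 1) => k.castSucc < i.castSucc) := by
      ext k
      simp [Fin.castSucc_lt_succ_iff, le_iff_eq_or_lt]
    rw [e, Finset.sum_insert (by simp), ih]
    ring

/-- The subdivision of `[0, 1)` at the points of a finite set. -/
theorem exists_subdivision (T : Finset ℝ) (h0 : 0 ∈ T) (h1 : 1 ∈ T)
    (hT : ∀ t ∈ T, 0 ≤ t ∧ t ≤ 1) :
    ∃ M, M + 2 = T.card ∧ ∃ S : Subdivision M, ∀ n (u : stdSimplex ℝ (Fin (n + 1))),
      (∀ j, partialSum u j ∈ T) → S.Adapted u := by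
  have hcard : 2 ≤ T.card := by
    have : ({0, 1} : Finset ℝ) ⊆ T := by
      intro x hx
      rcases Finset.mem_insert.1 hx with rfl | hx
      · exact h0
      · exact (Finset.mem_singleton.1 hx) ▸ h1
    exact (Finset.card_pair (zero_ne_one (α := ℝ))).symm ▸ Finset.card_le_card this
  obtain ⟨M, hM⟩ : ∃ M, T.card = M + 2 := ⟨T.card - 2, by omega⟩
  let g := T.orderEmbOfFin hM
  have gmem : ∀ r, g r ∈ T := T.orderEmbOfFin_mem hM
  have gsurj : ∀ t ∈ T, ∃ r, g r = t := by
    intro t ht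
    have := T.range_orderEmbOfFin hM
    rw [← Finset.mem_coe, ← this] at ht
    exact ht
  have g0 : g 0 = 0 := by
    obtain ⟨r, hr⟩ := gsurj 0 h0
    exact le_antisymm (hr ▸ g.monotone (Fin.zero_le r)) (hT _ (gmem 0)).1
  have g1 : g (Fin.last _) = 1 := by
    obtain ⟨r, hr⟩ := gsurj 1 h1
    exact le_antisymm (hT _ (gmem _)).2 (hr ▸ g.monotone (Fin.le_last r))
  have hlt : ∀ k : Fin (M + 1), g k.castSucc < g k.succ := fun k =>
    g.strictMono Fin.castSucc_lt_succ
  let v : stdSimplex ℝ (Fin (M + 1)) := ⟨fun k => g k.succ - g k.castSucc,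
    fun k => sub_nonneg.2 (hlt k).le, by
      have := sum_gaps g (Fin.last _)
      simpa [Fin.castSucc_lt_last, g0, g1] using this⟩
  have hv : ∀ k, v k = g k.succ - g k.castSucc := fun _ => rfl
  let S : Subdivision M :=
    { len := v
      left := ⟨fun k => ⟨g k.castSucc, (hT _ (gmem _)).1,
        (hlt k).trans_le (hT _ (gmem _)).2⟩,
        fun k l h => g.monotone (Fin.castSucc_le_castSucc_iff.2 h)⟩
      len_pos := fun k => by rw [hv]; linarith [hlt k]
      right_le_one := fun k => by
        have := (hT _ (gmem k.succ)).2
        show g k.castSucc + v k ≤ 1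
        rw [hv]; linarith
      right_le := fun k l h => by
        have : g k.succ ≤ g l.castSucc := g.monotone (Fin.succ_le_castSucc_iff.2 h)
        show g k.castSucc + v k ≤ g l.castSucc
        rw [hv]; linarith }
  refine ⟨M, hM.symm, S, fun n u hu => ⟨eq_of_partialSum_eq fun j => ?_, fun k t ht ht' => ?_⟩⟩
  · obtain ⟨r, hr⟩ := gsurj _ (hu j)
    have := sum_gaps g r
    rw [g0, sub_zero, hr] at this
    rw [partialSum_map, ← this]
    refine Finset.sum_congr ?_ fun _ _ => rfl
    ext k
    simp only [Finset.mem_filter, Finset.mem_univ, true_and]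
    rw [sample_apply, stepFun_le_iff, ← hr]
    exact g.lt_iff_lt
  · refine eq_of_forall_ge_iff fun j => ?_
    rw [stepFun_le_iff, stepFun_le_iff]
    refine ⟨fun h => lt_of_le_of_lt (show (S.left k).1 ≤ t.1 from ht) h, fun h => ?_⟩
    obtain ⟨r, hr⟩ := gsurj _ (hu j)
    rw [← hr] at h ⊢
    have h' : k.castSucc < r := g.lt_iff_lt.1 h
    have h2 : g k.succ ≤ g r := g.monotone (Fin.castSucc_lt_iff_succ_le.1 h')
    refine lt_of_lt_of_le ht' (le_trans (le_of_eq ?_) h2)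
    show g k.castSucc + v k = g k.succ
    rw [hv]; ring

/-- Finitely many points of simplices have a common adapted subdivision, with a bound on the number
of its intervals in terms of the dimensions. -/
theorem exists_adapted {ι : Type*} [Fintype ι] (n : ι → ℕ)
    (u : ∀ i, stdSimplex ℝ (Fin (n i + 1))) :
    ∃ M ≤ ∑ i, (n i + 1), ∃ S : Subdivision M, ∀ i, S.Adapted (u i) := by
  classical
  -- The jumps of the step functions, together with the end points of `[0, 1]`.
  let T : Finset ℝ := {0, 1} ∪ Finset.univ.biUnion fun i => Finset.univ.image (partialSum (u i))
  obtain ⟨M, hM, S, hS⟩ := exists_subdivision T (by simp [T]) (by simp [T]) (by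
    intro t ht
    simp only [T, Finset.mem_union, Finset.mem_insert, Finset.mem_singleton, Finset.mem_biUnion,
      Finset.mem_univ, true_and, Finset.mem_image] at ht
    rcases ht with (rfl | rfl) | ⟨i, j, rfl⟩
    · simp
    · simp
    · exact ⟨partialSum_nonneg _ _, partialSum_le_one _ _⟩)
  refine ⟨M, ?_, S, fun i => hS _ _ fun j => ?_⟩
  · have h1 : T.card ≤ 2 + ∑ i, (n i + 1) := by
      refine (Finset.card_union_le _ _).trans (add_le_add Finset.card_le_two ?_)
      refine Finset.card_biUnion_le.trans (Finset.sum_le_sum fun i _ => ?_)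
      exact Finset.card_image_le.trans (by simp)
    omega
  · simp only [T, Finset.mem_union, Finset.mem_biUnion, Finset.mem_univ, true_and,
      Finset.mem_image]
    exact Or.inr ⟨i, j, rfl⟩

/-- A subdivision is adapted to a point of `|X|` if the point can be recovered from its value at the
chain of left end points, and has the same value at each chain with one point in each interval. -/
structure Subdivision.AdaptedPt {M : ℕ} (S : Subdivision M) {X : SimplicialObject TopCat.{u}}
    (p : realization X) : Prop where
  mk_evalAt : realizationMk X M S.len (evalAt X S.left p) = p
  const : ∀ τ : Fin (M + 1) →o HalfOpenUnit,
    (∀ k, S.left k ≤ τ k ∧ (τ k).1 < (S.left k).1 + S.len k) → evalAt X τ p = evalAt X S.left p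

theorem Subdivision.Adapted.adaptedPt {M n : ℕ} {S : Subdivision M} {u : stdSimplex ℝ (Fin (n + 1))}
    (h : S.Adapted u) {X : SimplicialObject TopCat.{u}} (x : level X n) :
    S.AdaptedPt (realizationMk X n u x) where
  mk_evalAt := by rw [evalAt_mk, realizationMk_map, h.map_sample]
  const τ hτ := by
    rw [evalAt_mk, evalAt_mk]
    have : sample u τ = sample u S.left := by
      ext k
      exact congrArg Fin.val (h.const k (τ k) (hτ k).1 (hτ k).2)
    rw [this]

theorem exists_adaptedPt {ι : Type*} [Finite ι] {Y : ι → SimplicialObject TopCat.{u}}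
    (p : ∀ i, realization (Y i)) :
    ∃ (M : ℕ) (S : Subdivision M), ∀ i, S.AdaptedPt (p i) := by
  have := Fintype.ofFinite ι
  choose n u x h using fun i => exists_realizationMk (Y i) (p i)
  obtain ⟨M, -, S, hS⟩ := exists_adapted n u
  exact ⟨M, S, fun i => h i ▸ (hS i).adaptedPt (x i)⟩

theorem exists_adaptedPt_pair {X Y : SimplicialObject TopCat.{u}} (p : realization X)
    (q : realization Y) : ∃ (M : ℕ) (S : Subdivision M), S.AdaptedPt p ∧ S.AdaptedPt q := by
  obtain ⟨n, u, x, rfl⟩ := exists_realizationMk X p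
  obtain ⟨k, w, y, rfl⟩ := exists_realizationMk Y q
  obtain ⟨M, -, S, hS⟩ := exists_adapted (fun b : Bool => bif b then n else k)
    (fun b => match b with | true => u | false => w)
  exact ⟨M, S, (hS true).adaptedPt x, (hS false).adaptedPt y⟩

/-! ### Injectivity of realized inclusions -/

theorem realizationMap_injective {X Y : SimplicialObject TopCat.{u}} (f : X ⟶ Y)
    (hf : ∀ n, Function.Injective (levelMap f n)) : Function.Injective (realizationMap f) := by
  intro p q h
  obtain ⟨M, S, hp, hq⟩ := exists_adaptedPt_pair p q
  rw [← hp.mk_evalAt, ← hq.mk_evalAt]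
  congr 1
  apply hf
  rw [← evalAt_realizationMap, ← evalAt_realizationMap, h]

/-! ### Realizations of simplicial sets are Hausdorff -/

section Hausdorff

open MeasureTheory

/-- The chain with one point in each interval of a subdivision, at the relative position `s k / 2`
in the `k`-th interval. The factor `1 / 2` keeps the points off the right end points, which do not
belong to the intervals. -/
noncomputable def Subdivision.chain {M : ℕ} (S : Subdivision M) (s : Fin (M + 1) → unitInterval) :
    Fin (M + 1) →o HalfOpenUnit where
  toFun k := ⟨(S.left k).1 + (s k).1 * (S.len k / 2), by
      have h1 := S.len_pos k
      have h2 := (s k).2.1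
      have h3 := (S.left k).2.1
      positivity, by
      have h1 := S.len_pos k
      have h2 := (s k).2.2
      have h3 := S.right_le_one k
      nlinarith⟩
  monotone' k l h := by
    rcases h.eq_or_lt with rfl | h
    · exact le_rfl
    · have h1 := S.len_pos k
      have h2 := (s k).2.2
      have h3 := S.right_le k l h
      have h4 := S.len_pos l
      have h5 := (s l).2.1
      show (S.left k).1 + (s k).1 * (S.len k / 2) ≤ (S.left l).1 + (s l).1 * (S.len l / 2)
      have h6 : 0 ≤ (s l).1 * (S.len l / 2) := by positivity
      nlinarith

theorem Subdivision.AdaptedPt.evalAt_chain {M : ℕ} {S : Subdivision M}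
    {X : SimplicialObject TopCat.{u}} {p : realization X} (h : S.AdaptedPt p)
    (s : Fin (M + 1) → unitInterval) : evalAt X (S.chain s) p = evalAt X S.left p := by
  refine h.const _ fun k => ⟨?_, ?_⟩
  · have h1 := S.len_pos k
    have h2 := (s k).2.1
    show (S.left k).1 ≤ (S.left k).1 + (s k).1 * (S.len k / 2)
    have : 0 ≤ (s k).1 * (S.len k / 2) := by positivity
    linarith
  · have h1 := S.len_pos k
    have h2 := (s k).2.2
    show (S.left k).1 + (s k).1 * (S.len k / 2) < (S.left k).1 + S.len k
    nlinarith

/-- The probability that a point of `|X|`, viewed as a step function, takes the value `x` at a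
random chain with one point in each interval of the subdivision `S`. -/
noncomputable def valueProb {X : SimplicialObject TopCat.{u}} {M : ℕ} (S : Subdivision M)
    (x : level X M) (p : realization X) : ℝ :=
  ∫ s : Fin (M + 1) → unitInterval, Set.indicator {x} 1 (evalAt X (S.chain s) p)

theorem measurable_stepFun_chain {M n : ℕ} (S : Subdivision M) (u : stdSimplex ℝ (Fin (n + 1)))
    (k : Fin (M + 1)) : Measurable fun s : Fin (M + 1) → unitInterval =>
      stepFun u (S.chain s k) := by
  refine measurable_of_Iic fun j => ?_
  have : (fun s : Fin (M + 1) → unitInterval => stepFun u (S.chain s k)) ⁻¹' Set.Iic j =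
      {s | (S.left k).1 + (s k).1 * (S.len k / 2) < partialSum u j} := by
    ext s
    exact stepFun_le_iff u _ j
  rw [this]
  refine measurableSet_lt ?_ measurable_const
  exact measurable_const.add (((measurable_subtype_coe).comp (measurable_pi_apply k)).mul_const _)

theorem ae_chain_ne {M : ℕ} (S : Subdivision M) (k : Fin (M + 1)) (t : ℝ) :
    ∀ᵐ s : Fin (M + 1) → unitInterval, (S.chain s k).1 ≠ t := by
  have h1 := S.len_pos k
  by_cases h : ∃ a : unitInterval, (S.left k).1 + a.1 * (S.len k / 2) = t
  · obtain ⟨a, rfl⟩ := h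
    filter_upwards [Measure.ae_eval_ne (fun _ : Fin (M + 1) => (volume : Measure unitInterval)) k a]
      with s hs e
    refine hs (Subtype.ext ?_)
    have e' : (s k).1 * (S.len k / 2) = a.1 * (S.len k / 2) := add_left_cancel e
    exact mul_right_cancel₀ (by positivity) e'
  · exact Filter.Eventually.of_forall fun s e => h ⟨s k, e⟩

theorem eventually_stepFun_eq {n : ℕ} (u : stdSimplex ℝ (Fin (n + 1))) (t : HalfOpenUnit)
    (h : ∀ j, t.1 ≠ partialSum u j) : ∀ᶠ w in 𝓝 u, stepFun w t = stepFun u t := by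
  have : ∀ᶠ w in 𝓝 u, ∀ j, t.1 < partialSum w j ↔ t.1 < partialSum u j := by
    refine Filter.eventually_all.2 fun j => ?_
    have hc := (continuous_partialSum j).tendsto u
    rcases lt_or_gt_of_ne (h j) with hj | hj
    · filter_upwards [hc.eventually (lt_mem_nhds hj)] with w hw
      exact iff_of_true hw hj
    · filter_upwards [hc.eventually (gt_mem_nhds hj)] with w hw
      exact iff_of_false hw.not_gt hj.not_gt
  filter_upwards [this] with w hw
  refine eq_of_forall_ge_iff fun j => ?_
  rw [stepFun_le_iff, stepFun_le_iff, hw]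

/-- A small change of the coordinates changes a step function only on a set of small measure. -/
theorem continuous_valueProb_mk {X : SimplicialObject TopCat.{u}} {M n : ℕ} (S : Subdivision M)
    (x : level X M) (y : level X n) :
    Continuous fun u : stdSimplex ℝ (Fin (n + 1)) => valueProb S x (realizationMk X n u y) := by
  classical
  refine continuous_iff_continuousAt.2 fun u => ?_
  unfold valueProb
  simp only [evalAt_mk]
  refine continuousAt_of_dominated (bound := fun _ => 1) (Filter.Eventually.of_forall fun w => ?_)
    (Filter.Eventually.of_forall fun w => Filter.Eventually.of_forall fun s => ?_)
    (integrable_const _) ?_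
  · let F : (Fin (M + 1) → Fin (n + 1)) → ℝ := fun f =>
      if hf : Monotone f then
        Set.indicator {x} 1 (X.map (SimplexCategory.mkHom ⟨f, hf⟩).op y) else 0
    have hF : Measurable F := measurable_of_finite F
    have hs : Measurable fun s : Fin (M + 1) → unitInterval =>
        fun k => stepFun w (S.chain s k) :=
      measurable_pi_iff.2 fun k => measurable_stepFun_chain S w k
    have e : (fun s : Fin (M + 1) → unitInterval =>
        Set.indicator {x} (1 : level X M → ℝ) (X.map (sample w (S.chain s)).op y)) =
        F ∘ fun s => fun k => stepFun w (S.chain s k) := by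
      funext s
      have hm : Monotone fun k => stepFun w (S.chain s k) :=
        (stepFun_mono w).comp (S.chain s).monotone
      simp only [Function.comp_apply, F]
      rw [dif_pos hm]
      rfl
    rw [e]
    exact (hF.comp hs).aestronglyMeasurable
  · by_cases h : X.map (sample w (S.chain s)).op y = x <;> simp [Set.indicator, h]
  · have hae : ∀ᵐ s : Fin (M + 1) → unitInterval, ∀ k j, (S.chain s k).1 ≠ partialSum u j :=
      ae_all_iff.2 fun k => ae_all_iff.2 fun j => ae_chain_ne S k _
    filter_upwards [hae] with s hs
    have hev : ∀ᶠ w in 𝓝 u, sample w (S.chain s) = sample u (S.chain s) := by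
      have : ∀ᶠ w in 𝓝 u, ∀ k, stepFun w (S.chain s k) = stepFun u (S.chain s k) :=
        Filter.eventually_all.2 fun k => eventually_stepFun_eq u _ (hs k)
      filter_upwards [this] with w hw
      ext k
      exact congrArg Fin.val (hw k)
    refine ContinuousAt.congr
      (f := fun _ => Set.indicator {x} 1 (X.map (sample u (S.chain s)).op y))
      continuousAt_const ?_
    filter_upwards [hev] with w hw
    rw [hw]

theorem continuous_valueProb {X : SimplicialObject TopCat.{u}} (hX : IsDiscrete X) {M : ℕ}
    (S : Subdivision M) (x : level X M) : Continuous (valueProb S x) := by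
  refine isQuotientMap_quot_mk.continuous_iff.2 (continuous_sigma fun n => ?_)
  have := hX n
  exact continuous_prod_of_discrete_right.2 fun y => continuous_valueProb_mk S x y

/-- The realization of a simplicial set is Hausdorff: two points with different step functions
are separated by the probability of the values of one of them. -/
theorem t2Space_realization {X : SimplicialObject TopCat.{u}} (hX : IsDiscrete X) :
    T2Space (realization X) := by
  refine T2Space.of_injective_continuous
    (f := fun p (a : Σ M, Subdivision M × level X M) => valueProb a.2.1 a.2.2 p) ?_
    (continuous_pi fun a => continuous_valueProb hX a.2.1 a.2.2)
  intro p q h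
  obtain ⟨M, S, hp, hq⟩ := exists_adaptedPt_pair p q
  have h1 := congrFun h ⟨M, S, evalAt X S.left p⟩
  simp only [valueProb, hp.evalAt_chain, hq.evalAt_chain] at h1
  have h2 : evalAt X S.left q = evalAt X S.left p := by
    by_contra hne
    simp [Set.indicator, hne] at h1
  rw [← hp.mk_evalAt, ← hq.mk_evalAt, h2]

end Hausdorff

/-! ### Compactly generated spaces -/

/-- The topologies that a convention puts on a set agree on maps from compactly generated
spaces. -/
theorem Convention.continuous_refine_rng (c : Convention) {α β : Type u} [tα : TopologicalSpace α]
    [CompactlyGeneratedSpace α] {s : TopologicalSpace β} {f : α → β} (hf : Continuous[tα, s] f) :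
    Continuous[tα, c.refine s] f := by
  cases c with
  | classical => exact hf
  | compactlyGenerated =>
    have h := Convention.compactlyGenerated.continuous_refine hf
    have e : tα = TopologicalSpace.compactlyGenerated.{u} α := eq_compactlyGenerated
    have e' : Convention.compactlyGenerated.refine tα = tα := e.symm
    rwa [e'] at h

theorem compactlyGeneratedSpace_compactlyGenerated (α : Type u) [t : TopologicalSpace α] :
    @UCompactlyGeneratedSpace.{u} α (TopologicalSpace.compactlyGenerated.{u} α) :=
  @uCompactlyGeneratedSpace_of_coinduced _ _ _ (TopologicalSpace.compactlyGenerated.{u} α) _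
    _ continuous_coinduced_rng rfl

/-- The universal map from a disjoint union of compact Hausdorff spaces to a compactly generated
space is a quotient map. -/
theorem isQuotientMap_probes (P : Type u) [t : TopologicalSpace P] [CompactlyGeneratedSpace P] :
    IsQuotientMap
      (fun q : Σ (i : (S : CompHaus.{u}) × C(S, P)), i.fst => q.1.2 q.2) := by
  exact ⟨⟨eq_compactlyGenerated⟩,
    fun p => ⟨⟨⟨CompHaus.of PUnit, ContinuousMap.const _ p⟩, PUnit.unit⟩, rfl⟩⟩

/-- Continuity on the product of a locally compact and a compactly generated space is tested on
compact Hausdorff spaces mapping to the second factor. -/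
theorem continuous_prod_of_probes {Q T : Type*} {P : Type u} [TopologicalSpace Q]
    [LocallyCompactSpace Q] [TopologicalSpace P] [CompactlyGeneratedSpace P] [TopologicalSpace T]
    {g : Q × P → T}
    (h : ∀ (S : CompHaus.{u}) (b : C(S, P)), Continuous fun p : Q × S => g (p.1, b p.2)) :
    Continuous g := by
  refine (isQuotientMap_probes P).continuous_lift_prod_right (Y := Q) ?_
  have : Continuous fun q : (Σ (i : (S : CompHaus.{u}) × C(S, P)), i.fst) × Q =>
      g (q.2, q.1.1.2 q.1.2) := by
    rw [← (Homeomorph.sigmaProdDistrib (X := fun i : (S : CompHaus.{u}) × C(S, P) => i.fst)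
      (Y := Q)).symm.comp_continuous_iff']
    refine continuous_sigma fun i => ?_
    exact (h i.1 i.2).comp continuous_swap
  exact this.comp continuous_swap

theorem compactlyGeneratedSpace_prod (Q : Type) (P : Type u) [TopologicalSpace Q]
    [CompactSpace Q] [T2Space Q] [TopologicalSpace P] [CompactlyGeneratedSpace P] :
    CompactlyGeneratedSpace (Q × P) :=
  uCompactlyGeneratedSpace_of_continuous_maps fun f hf =>
    continuous_prod_of_probes fun S b =>
      hf (CompHaus.of (Q × S)) ⟨fun p => (p.1, b p.2), by fun_prop⟩

/-- A continuous map out of a product with a compact Hausdorff space remains continuous if the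
topologies of the other factor and of the target are replaced according to a convention. -/
theorem Convention.continuous_prod_refine (c : Convention) {Q : Type} {α β : Type u}
    [TopologicalSpace Q] [CompactSpace Q] [T2Space Q] {t : TopologicalSpace α}
    {s : TopologicalSpace β} {f : Q × α → β} (hf : Continuous f) :
    @Continuous _ _ (@instTopologicalSpaceProd Q α _ (c.refine t)) (c.refine s) f := by
  cases c with
  | classical => exact hf
  | compactlyGenerated =>
    have h1 : @Continuous _ _ (@instTopologicalSpaceProd Q α _
        (Convention.compactlyGenerated.refine t)) s f :=
      continuous_le_dom (inf_le_inf le_rfl (induced_mono (Convention.refine_le _ t))) hf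
    let _ := Convention.compactlyGenerated.refine t
    have : CompactlyGeneratedSpace α := @compactlyGeneratedSpace_compactlyGenerated α t
    have := compactlyGeneratedSpace_prod Q α
    exact Convention.compactlyGenerated.continuous_refine_rng h1

/-! ### Maps from products of realizations -/

/-- The quotient map from the disjoint union of the spaces `Δ[n] × X n` to `|X|`. -/
def toRealization (X : SimplicialObject TopCat.{u}) (q : PreRealization X) : realization X :=
  Quot.mk _ q

theorem isQuotientMap_toRealization (X : SimplicialObject TopCat.{u}) :
    IsQuotientMap (toRealization X) :=
  isQuotientMap_quot_mk

theorem continuous_realizationMk (X : SimplicialObject TopCat.{u}) (n : ℕ) :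
    Continuous fun p : stdSimplex ℝ (Fin (n + 1)) × level X n => realizationMk X n p.1 p.2 :=
  (isQuotientMap_toRealization X).continuous.comp (continuous_sigmaMk (σ := fun n : ℕ =>
    stdSimplex ℝ (Fin (n + 1)) × level X n))

theorem compactlyGeneratedSpace_preRealization {X : SimplicialObject TopCat.{u}}
    (hX : ∀ n, CompactlyGeneratedSpace (level X n)) :
    CompactlyGeneratedSpace (PreRealization X) := by
  have : ∀ n : ℕ, CompactlyGeneratedSpace (stdSimplex ℝ (Fin (n + 1)) × level X n) := fun n =>
    have := hX n
    compactlyGeneratedSpace_prod _ _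
  infer_instance

section Probes

variable {ι : Type} [Finite ι] {Y : ι → SimplicialObject TopCat.{u}}
  {W : SimplicialObject TopCat.{u}} {f : (∀ i, realization (Y i)) → realization W}
  {w : ∀ n, (∀ i, level (Y i) n) → level W n}

/-- A map on a product of realizations that is given levelwise is continuous on compact families
of points in fixed cells. The product of the simplices is covered by the finitely many simplices
of its subdivision into chambers, which are given by tuples of operators `φ i : [M] → [n i]`;
each of them contributes the compact set of all pairs of a parameter and a lift to `Δ[M]` of the
coordinates. -/
theorem continuous_of_levelwise_cells
    (hf : ∀ n v (y : ∀ i, level (Y i) n),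
      f (fun i => realizationMk (Y i) n v (y i)) = realizationMk W n v (w n y))
    (hw : ∀ n (K : CompHaus.{u}) (b : C(K, ∀ i, level (Y i) n)), Continuous fun s => w n (b s))
    (K : Type u) [TopologicalSpace K] [CompactSpace K] [T2Space K] (n : ι → ℕ)
    (u : ∀ i, C(K, stdSimplex ℝ (Fin (n i + 1)))) (x : ∀ i, C(K, level (Y i) (n i))) :
    Continuous fun s => f fun i => realizationMk (Y i) (n i) (u i s) (x i s) := by
  have := Fintype.ofFinite ι
  let J : Type := Σ M : Fin (∑ i, (n i + 1) + 1), ∀ i, Fin (M.1 + 1) →o Fin (n i + 1)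
  have : Finite J := by
    have : ∀ a b : ℕ, Finite (Fin a →o Fin b) := fun a b => DFunLike.finite _
    infer_instance
  -- The compact space of parameters in a given chamber, with their coordinates in the chamber.
  let E : J → Type u := fun j =>
    {p : K × stdSimplex ℝ (Fin (j.1.1 + 1)) // ∀ i, stdSimplex.map (j.2 i) p.2 = u i p.1}
  have hE : ∀ j, CompactSpace (E j) := fun j => by
    refine isCompact_iff_compactSpace.1 (IsClosed.isCompact ?_)
    have : {p : K × stdSimplex ℝ (Fin (j.1.1 + 1)) |
        ∀ i, stdSimplex.map (j.2 i) p.2 = u i p.1} =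
        ⋂ i, {p | stdSimplex.map (j.2 i) p.2 = u i p.1} := by
      ext; simp
    show IsClosed {p : K × stdSimplex ℝ (Fin (j.1.1 + 1)) |
      ∀ i, stdSimplex.map (j.2 i) p.2 = u i p.1}
    exact this ▸ isClosed_iInter fun i => isClosed_eq
      ((stdSimplex.continuous_map _).comp continuous_snd) ((u i).continuous.comp continuous_fst)
  let π : (Σ j, E j) → K := fun e => e.2.1.1
  have hπ : Continuous π :=
    continuous_sigma fun j => continuous_fst.comp continuous_subtype_val
  have hsurj : Function.Surjective π := by
    intro s
    obtain ⟨M, hM, S, hS⟩ := exists_adapted n fun i => u i s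
    exact ⟨⟨⟨⟨M, Nat.lt_succ_of_le hM⟩, fun i => (sample (u i s) S.left).toOrderHom⟩,
      ⟨(s, S.len), fun i => (hS i).map_sample⟩⟩, rfl⟩
  rw [(hπ.isClosedMap.isQuotientMap hπ hsurj).continuous_iff]
  refine continuous_sigma fun j => ?_
  let φ : ∀ i, SimplexCategory.mk j.1.1 ⟶ SimplexCategory.mk (n i) := fun i =>
    SimplexCategory.mkHom (j.2 i)
  have e : (fun p : E j => f fun i =>
      realizationMk (Y i) (n i) (u i p.1.1) (x i p.1.1)) = fun p =>
      realizationMk W j.1.1 p.1.2 (w _ fun i => (Y i).map (φ i).op (x i p.1.1)) := by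
    funext p
    rw [← hf]
    congr 1
    funext i
    rw [realizationMk_map, ← p.2 i]
    rfl
  show Continuous fun p : E j => f fun i => realizationMk (Y i) (n i) (u i p.1.1) (x i p.1.1)
  rw [e]
  have hb : Continuous fun p : E j => fun i => (Y i).map (φ i).op (x i p.1.1) :=
    continuous_pi fun i => ((Y i).map (φ i).op).hom.continuous.comp
      ((x i).continuous.comp (continuous_fst.comp continuous_subtype_val))
  exact (continuous_realizationMk W j.1.1).comp
    ((continuous_snd.comp continuous_subtype_val).prodMk (hw _ (CompHaus.of (E j)) ⟨_, hb⟩))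

/-- Continuity on compact families in the disjoint unions of the spaces `Δ[n] × X n`: the dimensions
are locally constant, so this reduces to families in fixed cells. -/
theorem continuous_of_levelwise_lifts
    (hf : ∀ n v (y : ∀ i, level (Y i) n),
      f (fun i => realizationMk (Y i) n v (y i)) = realizationMk W n v (w n y))
    (hw : ∀ n (K : CompHaus.{u}) (b : C(K, ∀ i, level (Y i) n)), Continuous fun s => w n (b s))
    (K : Type u) [TopologicalSpace K] [CompactSpace K] [T2Space K]
    (b : ∀ i, C(K, PreRealization (Y i))) :
    Continuous fun s => f fun i => toRealization (Y i) (b i s) := by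
  refine continuous_iff_continuousAt.2 fun s₀ => ?_
  let n : ι → ℕ := fun i => (b i s₀).1
  let V : Set K := {s | ∀ i, (b i s).1 = n i}
  have hV : IsClopen V := by
    have : V = ⋂ i, (fun s => (b i s).1) ⁻¹' {n i} := by ext; simp [V]
    rw [this]
    refine isClopen_iInter_of_finite fun i => (isClopen_discrete {n i}).preimage ?_
    exact (continuous_sigma fun _ => continuous_const).comp (b i).continuous
  have : CompactSpace V := isCompact_iff_compactSpace.1 hV.1.isCompact
  have hex : ∀ i (s : V), ∃ y : stdSimplex ℝ (Fin (n i + 1)) × level (Y i) (n i),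
      (⟨n i, y⟩ : PreRealization (Y i)) = b i s := fun i s => by
    have := s.2 i
    revert this
    generalize b i s = q
    obtain ⟨k, y⟩ := q
    rintro (rfl : k = n i)
    exact ⟨y, rfl⟩
  choose y hy using hex
  have hyc : ∀ i, Continuous (y i) := fun i => by
    rw [(IsOpenEmbedding.sigmaMk (σ := fun n : ℕ => stdSimplex ℝ (Fin (n + 1)) ×
      level (Y i) n) (i := n i)).continuous_iff]
    have : (Sigma.mk (n i) ∘ y i : V → PreRealization (Y i)) = fun s : V => b i s :=
      funext (hy i)
    rw [this]
    exact (b i).continuous.comp continuous_subtype_val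
  have h := continuous_of_levelwise_cells hf hw V n
    (fun i => ⟨fun s => (y i s).1, continuous_fst.comp (hyc i)⟩)
    (fun i => ⟨fun s => (y i s).2, continuous_snd.comp (hyc i)⟩)
  have hs₀ : s₀ ∈ V := fun i => rfl
  refine (hV.2.isOpenEmbedding_subtypeVal.continuousAt_iff (x := ⟨s₀, hs₀⟩)).1 ?_
  refine Continuous.continuousAt (h.congr fun s => ?_)
  refine congrArg f (funext fun i => ?_)
  exact congrArg (toRealization (Y i)) (hy i s)

/-- A map on a product of realizations of levelwise compactly generated simplicial spaces that is
given levelwise is continuous on compact Hausdorff spaces. The coordinates are lifted one by one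
from the realizations to the spaces of which these are quotients, since a product of a quotient
map with a compact Hausdorff space is a quotient map. -/
theorem continuous_of_levelwise (hY : ∀ i n, CompactlyGeneratedSpace (level (Y i) n))
    (hf : ∀ n v (y : ∀ i, level (Y i) n),
      f (fun i => realizationMk (Y i) n v (y i)) = realizationMk W n v (w n y))
    (hw : ∀ n (K : CompHaus.{u}) (b : C(K, ∀ i, level (Y i) n)), Continuous fun s => w n (b s))
    (K : CompHaus.{u}) (b : C(K, ∀ i, realization (Y i))) : Continuous fun s => f (b s) := by
  classical
  have := Fintype.ofFinite ι
  have key : ∀ (S : Finset ι) (K : Type u) [TopologicalSpace K] [CompactSpace K] [T2Space K]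
      (b : ∀ i, C(K, realization (Y i))),
      (∀ i ∉ S, ∃ b' : C(K, PreRealization (Y i)), ∀ s, b i s = toRealization (Y i) (b' s)) →
      Continuous fun s => f fun i => b i s := by
    intro S
    induction S using Finset.induction_on with
    | empty =>
      intro K _ _ _ b hb
      choose b' hb' using fun i => hb i (Finset.notMem_empty i)
      simp only [hb']
      exact continuous_of_levelwise_lifts hf hw K b'
    | insert i S hi ih =>
      intro K _ _ _ b hb
      have : CompactlyGeneratedSpace (PreRealization (Y i)) :=
        compactlyGeneratedSpace_preRealization (hY i)
      -- The coordinate `i` becomes an independent variable, which can then be lifted.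
      let g : K × realization (Y i) → realization W := fun p =>
        f (Function.update (fun j => b j p.1) i p.2)
      have hg : Continuous g := by
        refine (isQuotientMap_toRealization (Y i)).continuous_lift_prod_right
          (continuous_prod_of_probes
          (g := fun p : K × PreRealization (Y i) => g (p.1, toRealization (Y i) p.2)) fun T d => ?_)
        let b₂ : ∀ j, C(K × T, realization (Y j)) :=
          Function.update (fun j => (b j).comp ContinuousMap.fst) i
            ⟨fun p => toRealization (Y i) (d p.2),
              (isQuotientMap_toRealization (Y i)).continuous.comp
                (d.continuous.comp continuous_snd)⟩
        have hb₂i : ∀ p, b₂ i p = toRealization (Y i) (d p.2) := fun p => by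
          simp only [b₂, Function.update_self]; rfl
        have hb₂j : ∀ j, j ≠ i → ∀ p, b₂ j p = b j p.1 := fun j hj p => by
          simp only [b₂, Function.update_of_ne hj]; rfl
        refine (ih (K × T) b₂ fun j hj => ?_).congr fun p => ?_
        · by_cases hji : j = i
          · subst hji
            exact ⟨d.comp ContinuousMap.snd, hb₂i⟩
          · obtain ⟨b', hb'⟩ := hb j (by simp [hji, hj])
            exact ⟨b'.comp ContinuousMap.fst, fun s => (hb₂j j hji s).trans (hb' s.1)⟩
        · refine congrArg f (funext fun j => ?_)
          by_cases hji : j = i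
          · subst hji
            rw [hb₂i p]
            dsimp only
            rw [Function.update_self]
          · rw [hb₂j j hji p]
            dsimp only
            rw [Function.update_of_ne hji]
      refine (hg.comp (continuous_id.prodMk (b i).continuous)).congr fun s => ?_
      exact congrArg f (Function.update_eq_self i _)
  exact key Finset.univ K (fun i => ⟨fun s => b s i, (continuous_apply i).comp b.continuous⟩)
    fun i hi => absurd (Finset.mem_univ i) hi

end Probes

/-! ### Products of countable unions of compact sets -/

/-- A product of finitely many compact sets in an open set can be enlarged to a product of compact
neighbourhoods. -/
theorem exists_compact_box {ι : Type*} [Finite ι] {B : ι → Type*} [∀ i, TopologicalSpace (B i)]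
    [∀ i, LocallyCompactSpace (B i)] {L : ∀ i, Set (B i)} (hL : ∀ i, IsCompact (L i))
    {W : Set (∀ i, B i)} (hW : IsOpen W) (h : Set.univ.pi L ⊆ W) :
    ∃ L' : ∀ i, Set (B i), (∀ i, IsCompact (L' i)) ∧ (∀ i, L i ⊆ interior (L' i)) ∧
      Set.univ.pi L' ⊆ W := by
  classical
  have := Fintype.ofFinite ι
  have key : ∀ S : Finset ι, ∃ L' : ∀ i, Set (B i), (∀ i, IsCompact (L' i)) ∧
      (∀ i, L i ⊆ L' i) ∧ (∀ i ∈ S, L i ⊆ interior (L' i)) ∧ Set.univ.pi L' ⊆ W := by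
    intro S
    induction S using Finset.induction_on with
    | empty => exact ⟨L, hL, fun _ => subset_rfl, by simp, h⟩
    | insert i S hi ih =>
      obtain ⟨L', hc, hsub, hint, hW'⟩ := ih
      -- An empty factor needs no enlargement; otherwise a point `z` of it fills coordinate `i`.
      rcases (L' i).eq_empty_or_nonempty with he | ⟨z, hz⟩
      · refine ⟨L', hc, hsub, fun j hj => ?_, hW'⟩
        rcases Finset.mem_insert.1 hj with rfl | hj
        · exact ((hsub _).trans he.subset).trans (Set.empty_subset _)
        · exact hint j hj
      · have hopen : IsOpen ((fun p : (∀ j, B j) × B i => Function.update p.1 i p.2) ⁻¹' W) :=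
          hW.preimage (continuous_fst.update i continuous_snd)
        obtain ⟨U, V, -, hV, hU', hV', hUV⟩ := generalized_tube_lemma (isCompact_univ_pi hc)
          (hc i) hopen (by
            rintro ⟨x, y⟩ ⟨hx, hy⟩
            refine hW' fun j _ => ?_
            by_cases hj : j = i
            · subst hj
              simpa using hy
            · simpa [hj] using hx j trivial)
        obtain ⟨K, hK, hiK, hKV⟩ := exists_compact_between (hc i) hV hV'
        refine ⟨Function.update L' i K, fun j => ?_, fun j => ?_, fun j hj => ?_, fun x hx => ?_⟩
        · by_cases hj : j = i
          · subst hj; simpa using hK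
          · simpa [hj] using hc j
        · by_cases hj : j = i
          · subst hj
            simpa using (hsub j).trans (hiK.trans interior_subset)
          · simpa [hj] using hsub j
        · by_cases hji : j = i
          · subst hji
            simpa using (hsub j).trans hiK
          · simpa [hji] using hint j (Finset.mem_of_mem_insert_of_ne hj hji)
        · have h1 : Function.update x i z ∈ U := hU' fun j _ => by
            by_cases hj : j = i
            · subst hj; simpa using hz
            · simpa [hj] using hx j trivial
          have h2 : x i ∈ V := hKV (by simpa using hx i trivial)
          simpa using hUV (Set.mk_mem_prod h1 h2)
  obtain ⟨L', h1, -, h3, h4⟩ := key Finset.univ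
  exact ⟨L', h1, fun i => h3 i (Finset.mem_univ i), h4⟩

/-- A finite product of Hausdorff spaces, each with the weak topology of an increasing sequence of
compact sets, is compactly generated. A neighbourhood of a point in a set that is open on compact
spaces is the union of an increasing sequence of products of compact sets, each of which is a
neighbourhood of the preceding one relative to the next stage of the filtration. -/
theorem compactlyGeneratedSpace_pi {ι : Type} [Finite ι] {B : ι → Type u}
    [∀ i, TopologicalSpace (B i)] [∀ i, T2Space (B i)] (C : ∀ i, ℕ → Set (B i))
    (hmono : ∀ i, Monotone (C i)) (hC : ∀ i k, IsCompact (C i k)) (hcover : ∀ i x, ∃ k, x ∈ C i k)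
    (hcolim : ∀ i (U : Set (B i)), (∀ k, ∀ x ∈ U, x ∈ C i k → U ∈ 𝓝[C i k] x) → IsOpen U) :
    CompactlyGeneratedSpace (∀ i, B i) := by
  have := Fintype.ofFinite ι
  refine uCompactlyGeneratedSpace_of_isOpen fun s hs => isOpen_iff_mem_nhds.2 fun p hp => ?_
  have step : ∀ (k : ℕ) (L : ∀ i, Set (B i)),
      ((∀ i, IsCompact (L i)) ∧ (∀ i, L i ⊆ C i k) ∧ Set.univ.pi L ⊆ s) →
      ∃ L' : ∀ i, Set (B i), ((∀ i, IsCompact (L' i)) ∧ (∀ i, L' i ⊆ C i (k + 1)) ∧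
        Set.univ.pi L' ⊆ s) ∧ ∀ i, ∀ x ∈ L i, L' i ∈ 𝓝[C i (k + 1)] x := by
    rintro k L ⟨hL, hLC, hLs⟩
    have hcomp : ∀ i, CompactSpace (C i (k + 1)) := fun i =>
      isCompact_iff_compactSpace.1 (hC i (k + 1))
    have hW : IsOpen {y : ∀ i, C i (k + 1) | (fun i => (y i).1) ∈ s} :=
      hs (CompHaus.of (∀ i, C i (k + 1))) ⟨fun y i => (y i).1, by fun_prop⟩
    obtain ⟨L', h1, h2, h3⟩ := exists_compact_box
      (L := fun i => ((↑) : C i (k + 1) → B i) ⁻¹' L i)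
      (fun i => ((hL i).isClosed.preimage continuous_subtype_val).isCompact) hW
      (fun y hy => hLs fun i _ => hy i trivial)
    refine ⟨fun i => (↑) '' L' i, ⟨fun i => (h1 i).image continuous_subtype_val,
      fun i => Subtype.coe_image_subset _ _, fun x hx => ?_⟩, fun i x hx => ?_⟩
    · choose y hy hyx using fun i => hx i trivial
      have := h3 (show y ∈ Set.univ.pi L' from fun i _ => hy i)
      simpa [hyx] using this
    · have hxC : x ∈ C i (k + 1) := hmono i k.le_succ (hLC i hx)
      rw [nhdsWithin_eq_map_subtype_coe hxC]
      exact Filter.image_mem_map (mem_interior_iff_mem_nhds.1 (h2 i (show _ ∈ _ from hx)))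
  obtain ⟨k₀, hk₀⟩ : ∃ k₀, ∀ i, p i ∈ C i k₀ := by
    choose k hk using fun i => hcover i (p i)
    exact ⟨Finset.univ.sup k, fun i => hmono i (Finset.le_sup (Finset.mem_univ i)) (hk i)⟩
  choose! next hnext hnbhd using step
  let L : ℕ → ∀ i, Set (B i) := fun k => Nat.rec (fun i => {p i}) (fun k L => next (k₀ + k) L) k
  have hL : ∀ k, (∀ i, IsCompact (L k i)) ∧ (∀ i, L k i ⊆ C i (k₀ + k)) ∧
      Set.univ.pi (L k) ⊆ s := by
    intro k
    induction k with
    | zero =>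
      refine ⟨fun i => isCompact_singleton, fun i => Set.singleton_subset_iff.2 (hk₀ i), ?_⟩
      intro x hx
      have : x = p := funext fun i => hx i trivial
      exact this ▸ hp
    | succ k ih => exact hnext _ _ ih
  have hLn : ∀ k i, ∀ x ∈ L k i, L (k + 1) i ∈ 𝓝[C i (k₀ + k + 1)] x := fun k i x hx =>
    hnbhd _ _ (hL k) i x hx
  have hLmono : ∀ i, Monotone fun k => L k i := fun i => monotone_nat_of_le_succ fun k x hx =>
    mem_of_mem_nhdsWithin (hmono i (Nat.le_succ _) ((hL k).2.1 i hx)) (hLn k i x hx)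
  have hopen : ∀ i, IsOpen (⋃ k, L k i) := fun i => by
    refine hcolim i _ fun k x hx _ => ?_
    obtain ⟨j, hj⟩ := Set.mem_iUnion.1 hx
    have h1 : x ∈ L (max j k) i := hLmono i (le_max_left j k) hj
    have h2 : C i k ⊆ C i (k₀ + max j k + 1) := hmono i (by have := le_max_right j k; omega)
    exact nhdsWithin_mono x h2 (Filter.mem_of_superset (hLn _ i x h1)
      (Set.subset_iUnion (fun k => L k i) (max j k + 1)))
  refine Filter.mem_of_superset ((isOpen_set_pi Set.finite_univ fun i _ => hopen i).mem_nhds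
    fun i _ => Set.mem_iUnion.2 ⟨0, rfl⟩) fun x hx => ?_
  choose k hk using fun i => Set.mem_iUnion.1 (hx i trivial)
  exact (hL (Finset.univ.sup k)).2.2 fun i _ => hLmono i (Finset.le_sup (Finset.mem_univ i)) (hk i)

/-! ### Products of realizations of simplicial sets -/

theorem isCompact_range_realizationMk (X : SimplicialObject TopCat.{u}) (n : ℕ) (x : level X n) :
    IsCompact (Set.range fun v => realizationMk X n v x) :=
  isCompact_range ((continuous_realizationMk X n).comp (continuous_id.prodMk continuous_const))

theorem isOpen_realization_iff {X : SimplicialObject TopCat.{u}} (hX : IsDiscrete X)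
    (U : Set (realization X)) :
    IsOpen U ↔ ∀ n (x : level X n), IsOpen {v | realizationMk X n v x ∈ U} := by
  simp only [isOpen_iff_continuous_mem]
  rw [(isQuotientMap_toRealization X).continuous_iff, continuous_sigma_iff]
  refine forall_congr' fun n => ?_
  have := hX n
  exact continuous_prod_of_discrete_right

theorem compactlyGeneratedSpace_pi_realization_of_isCountable {ι : Type} [Finite ι]
    {Y : ι → SimplicialObject TopCat.{u}} (hY : ∀ i, IsCountable (Y i)) :
    CompactlyGeneratedSpace (∀ i, realization (Y i)) := by
  have hT2 := fun i => t2Space_realization (hY i).1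
  have hcount : ∀ i, Countable (Σ n, level (Y i) n) := fun i =>
    have := (hY i).2
    inferInstance
  choose e he using fun i => exists_injective_nat (Σ n, level (Y i) n)
  let cell : ∀ i, (Σ n, level (Y i) n) → Set (realization (Y i)) := fun i a =>
    Set.range fun v => realizationMk (Y i) a.1 v a.2
  refine compactlyGeneratedSpace_pi (fun i k => ⋃ a ∈ {a | e i a ≤ k}, cell i a)
    (fun i k l h => Set.biUnion_subset_biUnion_left fun a (ha : e i a ≤ k) => ha.trans h)
    (fun i k => ((Set.finite_Iic k).preimage (he i).injOn).isCompact_biUnion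
      fun a _ => isCompact_range_realizationMk _ _ _) (fun i p => ?_) (fun i U hU => ?_)
  · obtain ⟨n, v, x, rfl⟩ := exists_realizationMk (Y i) p
    exact ⟨e i ⟨n, x⟩, Set.mem_biUnion (x := ⟨n, x⟩) (le_refl (e i ⟨n, x⟩)) ⟨v, rfl⟩⟩
  · refine (isOpen_realization_iff (hY i).1 U).2 fun n x => isOpen_iff_mem_nhds.2 fun v hv => ?_
    have hmem : ∀ v, realizationMk (Y i) n v x ∈ ⋃ a ∈ {a | e i a ≤ e i ⟨n, x⟩}, cell i a :=
      fun v => Set.mem_biUnion (x := ⟨n, x⟩) (le_refl (e i ⟨n, x⟩)) ⟨v, rfl⟩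
    have hc : Continuous fun v => realizationMk (Y i) n v x :=
      (continuous_realizationMk (Y i) n).comp (continuous_id.prodMk continuous_const)
    exact (tendsto_nhdsWithin_iff.2 ⟨hc.tendsto v, Filter.Eventually.of_forall hmem⟩)
      (hU _ _ hv (hmem v))

theorem exists_mem_closedCell (X : SimplicialObject TopCat.{u}) (p : realization X) :
    ∃ s, p ∈ closedCell X s := by
  obtain ⟨n, v, x, rfl⟩ := exists_realizationMk X p
  obtain ⟨k, f, -, y, hy⟩ := SSet.exists_nonDegenerate (X ⋙ forget TopCat.{u}) x
  have hy' : x = X.map f.op y.1 := hy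
  exact ⟨⟨k, y⟩, stdSimplex.map f v, by rw [hy']; exact (realizationMk_map X f v y.1).symm⟩

theorem weaklyLocallyCompactSpace_realization {X : SimplicialObject TopCat.{u}}
    (hX : IsLocallyFinite X) : WeaklyLocallyCompactSpace (realization X) where
  exists_compact_mem_nhds p := by
    obtain ⟨U, hU, hfin⟩ := hX.2 p
    refine ⟨_, hfin.isCompact_biUnion fun s _ => isCompact_range_realizationMk X s.1 s.2.1,
      Filter.mem_of_superset hU fun q hq => ?_⟩
    obtain ⟨s, hs⟩ := exists_mem_closedCell X q
    exact Set.mem_biUnion (show s ∈ {s | (closedCell X s ∩ U).Nonempty} from ⟨q, hs, hq⟩) hs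

theorem compactlyGeneratedSpace_pi_realization_of_isLocallyFinite {ι : Type} [Finite ι]
    {Y : ι → SimplicialObject TopCat.{u}} (hY : ∀ i, IsLocallyFinite (Y i)) :
    CompactlyGeneratedSpace (∀ i, realization (Y i)) := by
  have hT2 := fun i => t2Space_realization (hY i).1
  have hlc := fun i => weaklyLocallyCompactSpace_realization (hY i)
  infer_instance

theorem IsLocallyFinite.of_injective {X Y : SimplicialObject TopCat.{u}} (f : Y ⟶ X)
    (hf : ∀ n, Function.Injective (f.app n)) (hY : IsDiscrete Y) (hX : IsLocallyFinite X) :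
    IsLocallyFinite Y := by
  refine ⟨hY, ?_⟩
  let g : (Y ⋙ forget TopCat.{u} : SSet.{u}) ⟶ X ⋙ forget TopCat.{u} := Functor.whiskerRight f _
  have hg : ∀ n, Mono (g.app n) := fun n => (mono_iff_injective _).2 (hf n)
  have : Mono g := NatTrans.mono_of_mono_app g
  have hnd : ∀ n (y : level Y n), y ∈ SSet.nonDegenerate (Y ⋙ forget TopCat.{u}) n →
      levelMap f n y ∈ SSet.nonDegenerate (X ⋙ forget TopCat.{u}) n := fun n y hy =>
    (SSet.nonDegenerate_iff_of_mono g y).2 hy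
  let F : NondegenerateSimplex Y → NondegenerateSimplex X := fun s =>
    ⟨s.1, levelMap f s.1 s.2.1, hnd _ _ s.2.2⟩
  have hF : Function.Injective F := by
    rintro ⟨n, y, hy⟩ ⟨k, z, hz⟩ h
    obtain rfl : n = k := congrArg Sigma.fst h
    have h2 := congrArg Subtype.val (eq_of_heq (Sigma.mk.inj h).2)
    obtain rfl : y = z := hf _ h2
    rfl
  refine ((hX.2.comp_injective hF).preimage_continuous
    (realizationMap f).hom.continuous).subset fun s => ?_
  rintro _ ⟨v, rfl⟩
  exact ⟨v, rfl⟩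

/-! ### The projection of a realized product and its inverse -/

section Bijections

variable (c : Convention) {m : ℕ} (X : Fin m → SimplicialObject TopCat.{u})

theorem realizationProdProj_injective : Function.Injective (realizationProdProj c X) := by
  intro p q h
  obtain ⟨M, S, hp, hq⟩ := exists_adaptedPt_pair p q
  rw [← hp.mk_evalAt, ← hq.mk_evalAt]
  congr 1
  funext i
  have hi : ∀ r : realization (prodSimplicial c X),
      evalAt (prodSimplicial c X) S.left r i =
        evalAt (X i) S.left (realizationProdProj c X r i) := fun r =>
    (evalAt_realizationMap (prodSimplicialProj c X i) S.left r).symm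
  rw [hi, hi, h]

/-- A point of the product of the realizations, written on a common subdivision. -/
theorem exists_realizationProdProj_mk (x : ∀ i, realization (X i)) :
    ∃ (M : ℕ) (S : Subdivision M), realizationProdProj c X
      (realizationMk (prodSimplicial c X) M S.len fun i => evalAt (X i) S.left (x i)) = x := by
  obtain ⟨M, S, hS⟩ := exists_adaptedPt x
  exact ⟨M, S, funext fun i => (hS i).mk_evalAt⟩

/-- The projection from the realization of the product to the product of the realizations, as a
bijection. -/
noncomputable def realizationProdEquiv :
    realization (prodSimplicial c X) ≃ prodSpace c fun i => realization (X i) :=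
  Equiv.ofBijective (realizationProdProj c X) ⟨realizationProdProj_injective c X, fun x =>
    let ⟨_, _, h⟩ := exists_realizationProdProj_mk c X x
    ⟨_, h⟩⟩

theorem realizationProdEquiv_symm_mk (n : ℕ) (v : stdSimplex ℝ (Fin (n + 1)))
    (y : ∀ i, level (X i) n) :
    (realizationProdEquiv c X).symm (fun i => realizationMk (X i) n v (y i)) =
      realizationMk (prodSimplicial c X) n v y :=
  (Equiv.symm_apply_eq _).2 rfl

variable {X} (K : LowerSet (Finset (Fin m))) (A : ∀ i, SimplicialSubspace (X i))

theorem exists_polyProd_lift (z : polyProd c K fun i => realizationPair (A i) c) :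
    ∃ p, realizationMap (polyProdSimplicialIncl c K A) p =
      (realizationProdEquiv c X).symm (polyProdIncl c K _ z) := by
  obtain ⟨x, σ, hσ, hx⟩ := z
  obtain ⟨M, S, h⟩ := exists_realizationProdProj_mk c X x
  refine ⟨realizationMk (polyProdSimplicial c K A) M S.len
    ⟨fun i => evalAt (X i) S.left (x i), σ, hσ, fun i hi => ?_⟩,
    ((Equiv.symm_apply_eq _).2 h.symm).symm⟩
  obtain ⟨a, ha⟩ := hx i hi
  exact ⟨evalAt _ S.left a, (evalAt_realizationMap ((A i).ι c) S.left a).symm.trans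
    (congrArg (evalAt (X i) S.left) ha)⟩

/-- The map from the polyhedral product of the realizations to the realization of the polyhedral
products that the inverse of the projection restricts to. -/
noncomputable def polyProdToRealization (z : polyProd c K fun i => realizationPair (A i) c) :
    realization (polyProdSimplicial c K A) :=
  (exists_polyProd_lift c K A z).choose

theorem realizationMap_polyProdToRealization (z : polyProd c K fun i => realizationPair (A i) c) :
    realizationMap (polyProdSimplicialIncl c K A) (polyProdToRealization c K A z) =
      (realizationProdEquiv c X).symm (polyProdIncl c K _ z) :=
  (exists_polyProd_lift c K A z).choose_spec

theorem realizationMap_polyProdSimplicialIncl_injective :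
    Function.Injective (realizationMap (polyProdSimplicialIncl c K A)) :=
  realizationMap_injective _ fun _ => Subtype.val_injective

/-- The map from the realization of the polyhedral products to the polyhedral product of the
realizations. -/
def realizationToPolyProd (p : realization (polyProdSimplicial c K A)) :
    polyProd c K fun i => realizationPair (A i) c :=
  ⟨realizationProdProj c X (realizationMap (polyProdSimplicialIncl c K A) p), by
    obtain ⟨n, v, ⟨z, σ, hσ, hz⟩, rfl⟩ := exists_realizationMk _ p
    refine ⟨σ, hσ, fun i hi => ?_⟩
    obtain ⟨a, ha⟩ := hz i hi
    exact ⟨realizationMk ((A i).toSimplicial c) n v a, congrArg (realizationMk (X i) n v) ha⟩⟩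

theorem realizationToPolyProd_polyProdToRealization
    (z : polyProd c K fun i => realizationPair (A i) c) :
    realizationToPolyProd c K A (polyProdToRealization c K A z) = z := by
  refine Subtype.ext ?_
  show realizationProdProj c X (realizationMap (polyProdSimplicialIncl c K A)
    (polyProdToRealization c K A z)) = z.1
  rw [realizationMap_polyProdToRealization]
  exact (realizationProdEquiv c X).apply_symm_apply _

theorem polyProdToRealization_realizationToPolyProd
    (p : realization (polyProdSimplicial c K A)) :
    polyProdToRealization c K A (realizationToPolyProd c K A p) = p := by
  apply realizationMap_polyProdSimplicialIncl_injective
  rw [realizationMap_polyProdToRealization]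
  exact (realizationProdEquiv c X).symm_apply_apply _

/-! ### Continuity of the projection and of its restriction -/

variable (X) in
theorem continuous_realizationProdProj : Continuous (realizationProdProj c X) := by
  rw [(isQuotientMap_toRealization _).continuous_iff]
  refine continuous_sigma fun n => ?_
  refine c.continuous_prod_refine (t := Pi.topologicalSpace) (s := Pi.topologicalSpace)
    (f := fun (p : stdSimplex ℝ (Fin (n + 1)) × ∀ i, level (X i) n) i =>
      realizationMk (X i) n p.1 (p.2 i)) (continuous_pi fun i => ?_)
  exact (continuous_realizationMk (X i) n).comp
    (continuous_fst.prodMk ((continuous_apply i).comp continuous_snd))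

end Bijections

/-- The product `D(σ)`, with the topology of the convention `c`. -/
def blockSpace (c : Convention) {m : ℕ} (P : Fin m → SpacePair.{u}) (σ : Finset (Fin m)) :
    TopCat.{u} :=
  @TopCat.of (Block P σ) (c.refine inferInstance)

section Blocks

variable {c : Convention} {m : ℕ} {K : LowerSet (Finset (Fin m))} {P : Fin m → SpacePair.{u}}

/-- The map from `D(σ)` to the polyhedral product. -/
def blockSpaceIncl (c : Convention) {m : ℕ} (K : LowerSet (Finset (Fin m)))
    (P : Fin m → SpacePair.{u}) (σ : {σ // σ ∈ K}) : blockSpace c P σ.1 → polyProd c K P :=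
  blockIncl K P σ

theorem continuous_blockSpaceIncl (σ : {σ // σ ∈ K}) : Continuous (blockSpaceIncl c K P σ) :=
  continuous_iff_coinduced_le.2 (le_iSup (fun σ : {σ // σ ∈ K} =>
    TopologicalSpace.coinduced (blockIncl K P σ)
      (c.refine (inferInstance : TopologicalSpace (Block P σ.1)))) σ)

theorem isQuotientMap_blockSpaceIncl :
    IsQuotientMap fun q : Σ σ : {σ // σ ∈ K}, blockSpace c P σ.1 =>
      blockSpaceIncl c K P q.1 q.2 := by
  refine ⟨⟨?_⟩, ?_⟩
  · refine (coinduced_iSup.trans (iSup_congr fun σ => ?_)).symm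
    exact coinduced_compose (f := Sigma.mk (β := fun σ : {σ // σ ∈ K} => blockSpace c P σ.1) σ)
  · rintro ⟨x, σ, hσ, hx⟩
    have hx' := hx
    choose a ha using hx'
    refine ⟨⟨⟨σ, hσ⟩, fun i => x i, fun i => a i i.2⟩, Subtype.ext (funext fun i => ?_)⟩
    by_cases hi : i ∈ σ
    · simp [blockSpaceIncl, blockIncl, blockMap, hi]
    · simp [blockSpaceIncl, blockIncl, blockMap, hi, ha]

theorem continuous_polyProd_iff {T : Type*} [TopologicalSpace T] {g : polyProd c K P → T} :
    Continuous g ↔ ∀ σ : {σ // σ ∈ K}, Continuous fun y => g (blockSpaceIncl c K P σ y) := by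
  rw [isQuotientMap_blockSpaceIncl.continuous_iff, continuous_sigma_iff]
  rfl

theorem continuous_prod_polyProd {Q T : Type*} [TopologicalSpace Q] [LocallyCompactSpace Q]
    [TopologicalSpace T] {g : Q × polyProd c K P → T}
    (h : ∀ σ : {σ // σ ∈ K}, Continuous fun p : Q × blockSpace c P σ.1 =>
      g (p.1, blockSpaceIncl c K P σ p.2)) : Continuous g := by
  refine isQuotientMap_blockSpaceIncl.continuous_lift_prod_right (Y := Q) ?_
  have : Continuous fun q : (Σ σ : {σ // σ ∈ K}, blockSpace c P σ.1) × Q =>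
      g (q.2, blockSpaceIncl c K P q.1.1 q.1.2) := by
    rw [← (Homeomorph.sigmaProdDistrib (X := fun σ : {σ // σ ∈ K} => blockSpace c P σ.1)
      (Y := Q)).symm.comp_continuous_iff']
    exact continuous_sigma fun σ => (h σ).comp continuous_swap
  exact this.comp continuous_swap

end Blocks

/-- The point with coordinates `[v, y i]` of the product `D(σ)` formed from the realizations. -/
def blockRealizationMk (c : Convention) {m : ℕ} {X : Fin m → SimplicialObject TopCat.{u}}
    (A : ∀ i, SimplicialSubspace (X i)) (σ : Finset (Fin m)) (n : ℕ)
    (v : stdSimplex ℝ (Fin (n + 1)))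
    (y : Block (fun i => levelPair (A i) c (op (SimplexCategory.mk n))) σ) :
    Block (fun i => realizationPair (A i) c) σ :=
  (fun i => realizationMk (X i) n v (y.1 i),
    fun i => realizationMk ((A i).toSimplicial c) n v (y.2 i))

theorem blockMap_blockRealizationMk (c : Convention) {m : ℕ}
    {X : Fin m → SimplicialObject TopCat.{u}} (A : ∀ i, SimplicialSubspace (X i))
    (σ : Finset (Fin m)) (n : ℕ) (v : stdSimplex ℝ (Fin (n + 1)))
    (y : Block (fun i => levelPair (A i) c (op (SimplexCategory.mk n))) σ) :
    blockMap (fun i => realizationPair (A i) c) σ (blockRealizationMk c A σ n v y) =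
      fun i => realizationMk (X i) n v (blockMap _ σ y i) := by
  funext i
  by_cases hi : i ∈ σ
  · have h : blockMap _ σ y i = y.1 ⟨i, hi⟩ := dif_pos hi
    exact (dif_pos hi).trans (congrArg (realizationMk (X i) n v) h.symm)
  · have h : blockMap _ σ y i = (levelPair (A i) c _).incl (y.2 ⟨i, hi⟩) := dif_neg hi
    exact (dif_neg hi).trans (congrArg (realizationMk (X i) n v) h.symm)

theorem continuous_blockRealizationMk (c : Convention) {m : ℕ}
    {X : Fin m → SimplicialObject TopCat.{u}} (A : ∀ i, SimplicialSubspace (X i))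
    (σ : Finset (Fin m)) (n : ℕ) :
    Continuous fun p : stdSimplex ℝ (Fin (n + 1)) ×
        Block (fun i => levelPair (A i) c (op (SimplexCategory.mk n))) σ =>
      blockRealizationMk c A σ n p.1 p.2 :=
  Continuous.prodMk
    (continuous_pi fun i => (continuous_realizationMk (X i) n).comp (continuous_fst.prodMk
      ((continuous_apply i).comp (continuous_fst.comp continuous_snd))))
    (continuous_pi fun i => (continuous_realizationMk ((A i).toSimplicial c) n).comp
      (continuous_fst.prodMk ((continuous_apply i).comp (continuous_snd.comp continuous_snd))))

theorem continuous_realizationToPolyProd (c : Convention) {m : ℕ}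
    {X : Fin m → SimplicialObject TopCat.{u}} (K : LowerSet (Finset (Fin m)))
    (A : ∀ i, SimplicialSubspace (X i)) : Continuous (realizationToPolyProd c K A) := by
  rw [(isQuotientMap_toRealization _).continuous_iff]
  refine continuous_sigma fun n => ?_
  refine continuous_prod_polyProd (P := fun i => levelPair (A i) c (op (SimplexCategory.mk n)))
    fun σ => ?_
  have h : @Continuous (stdSimplex ℝ (Fin (n + 1)) ×
      blockSpace c (fun i => levelPair (A i) c (op (SimplexCategory.mk n))) σ.1)
      (blockSpace c (fun i => realizationPair (A i) c) σ.1) _ _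
      fun p => blockRealizationMk c A σ.1 n p.1 p.2 :=
    c.continuous_prod_refine (continuous_blockRealizationMk c A σ.1 n)
  exact ((continuous_blockSpaceIncl (P := fun i => realizationPair (A i) c) σ).comp h).congr
    fun p => Subtype.ext (blockMap_blockRealizationMk c A σ.1 n p.1 p.2)

/-! ### Continuity of the inverse maps -/

theorem Convention.continuous_refine_dom (c : Convention) {α : Type u} {T : Type*}
    [t : TopologicalSpace α] [TopologicalSpace T]
    (hα : c = .classical → CompactlyGeneratedSpace α) {f : α → T}
    (h : ∀ (S : CompHaus.{u}) (b : C(S, α)), Continuous fun s => f (b s)) :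
    Continuous[c.refine t, _] f := by
  cases c with
  | classical =>
    have := hα rfl
    exact continuous_from_uCompactlyGeneratedSpace f h
  | compactlyGenerated => exact continuous_from_compactlyGenerated f h

theorem compactlyGeneratedSpace_compHaus (S : CompHaus.{u}) : CompactlyGeneratedSpace S :=
  have h (K : Type u) [TopologicalSpace K] [CompactSpace K] [T2Space K] :
      CompactlyGeneratedSpace K := inferInstance
  h S

theorem continuous_realizationProdEquiv_symm (c : Convention) {m : ℕ}
    {X : Fin m → SimplicialObject TopCat.{u}} (hX : ∀ i n, CompactlyGeneratedSpace (level (X i) n))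
    (hc : c = .classical → CompactlyGeneratedSpace (∀ i, realization (X i))) :
    Continuous (realizationProdEquiv c X).symm := by
  refine c.continuous_refine_dom hc fun S b => ?_
  exact continuous_of_levelwise (f := (realizationProdEquiv c X).symm) (w := fun n y => y) hX
    (realizationProdEquiv_symm_mk c X) (fun n K b =>
      have := compactlyGeneratedSpace_compHaus K
      c.continuous_refine_rng b.continuous) S b

/-- The factors of a product `D(σ)`, indexed by the elements of `σ` and of its complement. -/
abbrev blockFactors (c : Convention) {m : ℕ} {X : Fin m → SimplicialObject TopCat.{u}}
    (A : ∀ i, SimplicialSubspace (X i)) (σ : Finset (Fin m)) :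
    {i // i ∈ σ} ⊕ {i // i ∉ σ} → SimplicialObject TopCat.{u} :=
  Sum.elim (fun i => X i) fun i => (A i).toSimplicial c

theorem continuous_polyProdToRealization (c : Convention) {m : ℕ}
    {X : Fin m → SimplicialObject TopCat.{u}} (K : LowerSet (Finset (Fin m)))
    (A : ∀ i, SimplicialSubspace (X i)) (hX : ∀ i n, CompactlyGeneratedSpace (level (X i) n))
    (hA : ∀ i n, CompactlyGeneratedSpace (level ((A i).toSimplicial c) n))
    (hc : c = .classical → ∀ σ, CompactlyGeneratedSpace
      (∀ j, realization (blockFactors c A σ j))) :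
    Continuous (polyProdToRealization c K A) := by
  refine continuous_polyProd_iff.2 fun σ => ?_
  let e : (∀ j, realization (blockFactors c A σ.1 j)) ≃ₜ
      Block (fun i => realizationPair (A i) c) σ.1 :=
    Homeomorph.sumPiEquivProdPi _ _ fun j => realization (blockFactors c A σ.1 j)
  let F : Block (fun i => realizationPair (A i) c) σ.1 → realization (polyProdSimplicial c K A) :=
    fun y => polyProdToRealization c K A (blockIncl K _ σ y)
  have hF : Continuous[c.refine inferInstance, _] F := by
    refine c.continuous_refine_dom (fun h => ?_) fun S b => ?_
    · have := hc h σ.1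
      exact compactlyGeneratedSpace_of_coinduced e.continuous e.coinduced_eq.symm
    · refine (continuous_of_levelwise (Y := blockFactors c A σ.1)
        (f := fun y => polyProdToRealization c K A (blockIncl K _ σ (e y)))
        (w := fun n y => blockIncl K (fun i => levelPair (A i) c (op (SimplexCategory.mk n))) σ
          (fun i => y (Sum.inl i), fun i => y (Sum.inr i))) ?_ ?_ ?_ S
        ⟨fun s => e.symm (b s), e.symm.continuous.comp b.continuous⟩).congr fun s => ?_
      · rintro (i | i) n
        · exact hX i n
        · exact hA i n
      · intro n v y
        apply realizationMap_polyProdSimplicialIncl_injective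
        refine (realizationMap_polyProdToRealization c K A _).trans ?_
        exact (Equiv.symm_apply_eq _).2 (blockMap_blockRealizationMk c A σ.1 n v
          (fun i => y (Sum.inl i), fun i => y (Sum.inr i)))
      · intro n T d
        have := compactlyGeneratedSpace_compHaus T
        refine (continuous_blockSpaceIncl
          (P := fun i => levelPair (A i) c (op (SimplexCategory.mk n))) σ).comp
          (c.continuous_refine_rng ?_)
        exact Continuous.prodMk
          (continuous_pi fun i => (continuous_apply (Sum.inl i)).comp d.continuous)
          (continuous_pi fun i => (continuous_apply (Sum.inr i)).comp d.continuous)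
      · exact congrArg F (e.apply_symm_apply (b s))
  exact hF

/-! ### Finiteness conditions for simplicial subspaces -/

theorem SimplicialSubspace.isDiscrete {X : SimplicialObject TopCat.{u}} (hX : IsDiscrete X)
    (A : SimplicialSubspace X) : IsDiscrete (A.toSimplicial .classical) := fun n =>
  have := hX n
  inferInstanceAs (DiscreteTopology (A.carrier (op (SimplexCategory.mk n))))

theorem SimplicialSubspace.isCountable {X : SimplicialObject TopCat.{u}} (hX : IsCountable X)
    (A : SimplicialSubspace X) : IsCountable (A.toSimplicial .classical) :=
  ⟨A.isDiscrete hX.1, fun n =>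
    have := hX.2 n
    inferInstanceAs (Countable (A.carrier (op (SimplexCategory.mk n))))⟩

theorem SimplicialSubspace.isLocallyFinite {X : SimplicialObject TopCat.{u}}
    (hX : IsLocallyFinite X) (A : SimplicialSubspace X) :
    IsLocallyFinite (A.toSimplicial .classical) :=
  .of_injective (A.ι .classical) (fun _ => Subtype.val_injective) (A.isDiscrete hX.1) hX

theorem IsDiscrete.compactlyGeneratedSpace {X : SimplicialObject TopCat.{u}} (hX : IsDiscrete X)
    (n : ℕ) : CompactlyGeneratedSpace (level X n) :=
  have := hX n
  inferInstance

theorem Admissible.isDiscrete {m : ℕ} {X : Fin m → SimplicialObject TopCat.{u}}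
    (h : Admissible .classical X) (i : Fin m) : IsDiscrete (X i) := by
  rcases h with h | h
  · exact (h i).1
  · exact (h i).1

theorem Admissible.compactlyGeneratedSpace {c : Convention} {m : ℕ}
    {X : Fin m → SimplicialObject TopCat.{u}} (h : Admissible c X) (i : Fin m) (n : ℕ) :
    CompactlyGeneratedSpace (level (X i) n) := by
  cases c with
  | classical => exact (h.isDiscrete i).compactlyGeneratedSpace n
  | compactlyGenerated => exact (h i n).1

theorem Admissible.compactlyGeneratedSpace_sub {c : Convention} {m : ℕ}
    {X : Fin m → SimplicialObject TopCat.{u}} (h : Admissible c X)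
    (A : ∀ i, SimplicialSubspace (X i)) (i : Fin m) (n : ℕ) :
    CompactlyGeneratedSpace (level ((A i).toSimplicial c) n) := by
  cases c with
  | classical => exact ((A i).isDiscrete (h.isDiscrete i)).compactlyGeneratedSpace n
  | compactlyGenerated =>
    exact compactlyGeneratedSpace_compactlyGenerated ((A i).carrier (op (SimplexCategory.mk n)))

theorem Admissible.compactlyGeneratedSpace_pi {m : ℕ} {X : Fin m → SimplicialObject TopCat.{u}}
    (h : Admissible .classical X) : CompactlyGeneratedSpace (∀ i, realization (X i)) := by
  rcases h with h | h
  · exact compactlyGeneratedSpace_pi_realization_of_isCountable h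
  · exact compactlyGeneratedSpace_pi_realization_of_isLocallyFinite h

theorem Admissible.compactlyGeneratedSpace_blockFactors {m : ℕ}
    {X : Fin m → SimplicialObject TopCat.{u}} (h : Admissible .classical X)
    (A : ∀ i, SimplicialSubspace (X i)) (σ : Finset (Fin m)) :
    CompactlyGeneratedSpace (∀ j, realization (blockFactors .classical A σ j)) := by
  rcases h with h | h
  · refine compactlyGeneratedSpace_pi_realization_of_isCountable ?_
    rintro (i | i)
    · exact h i
    · exact (A i).isCountable (h i)
  · refine compactlyGeneratedSpace_pi_realization_of_isLocallyFinite ?_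
    rintro (i | i)
    · exact h i
    · exact (A i).isLocallyFinite (h i)


end PolyhedralProduct
open PolyhedralProduct in
theorem mainTheorem11 {m : ℕ} (K : LowerSet (Finset (Fin m))) (hK : ∅ ∈ K)
    (X : Fin m → SimplicialObject TopCat.{u}) (A : ∀ i, SimplicialSubspace (X i))
    (c : Convention) :
    (∀ i, Function.Injective (realizationPair (A i) c).incl) ∧
    Function.Injective (realizationMap (polyProdSimplicialIncl c K A)) ∧
    ∃ (η : prodSpace c (fun i => realization (X i)) → realization (prodSimplicial c X))
      (h : polyProd c K (fun i => realizationPair (A i) c) →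
        realization (polyProdSimplicial c K A)),
      Function.LeftInverse η (realizationProdProj c X) ∧
      Function.RightInverse η (realizationProdProj c X) ∧
      (∀ z, realizationMap (polyProdSimplicialIncl c K A) (h z) =
        η (polyProdIncl c K (fun i => realizationPair (A i) c) z)) ∧
      (Admissible c X → IsHomeomorph η ∧ IsHomeomorph h) := by
  refine ⟨fun i => realizationMap_injective _ fun _ => Subtype.val_injective,
    realizationMap_polyProdSimplicialIncl_injective c K A, (realizationProdEquiv c X).symm,
    polyProdToRealization c K A, (realizationProdEquiv c X).symm_apply_apply,
    (realizationProdEquiv c X).apply_symm_apply, realizationMap_polyProdToRealization c K A,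
    fun hadm => ⟨?_, ?_⟩⟩
  · exact isHomeomorph_iff_exists_inverse.2
      ⟨continuous_realizationProdEquiv_symm c hadm.compactlyGeneratedSpace
        (by rintro rfl; exact hadm.compactlyGeneratedSpace_pi),
      realizationProdProj c X, (realizationProdEquiv c X).apply_symm_apply,
      (realizationProdEquiv c X).symm_apply_apply, continuous_realizationProdProj c X⟩
  · exact isHomeomorph_iff_exists_inverse.2
      ⟨continuous_polyProdToRealization c K A hadm.compactlyGeneratedSpace
        (hadm.compactlyGeneratedSpace_sub A)
        (by rintro rfl; exact hadm.compactlyGeneratedSpace_blockFactors A),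
      realizationToPolyProd c K A, realizationToPolyProd_polyProdToRealization c K A,
      polyProdToRealization_realizationToPolyProd c K A, continuous_realizationToPolyProd c K A⟩
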